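/- A FACTS linear-DC (LDC) power network consists of a finite set of nodes, disjoint sets of generators and loads among the nodes, and finitely many lines; a line $e=ab$ joins two distinct nodes $a,b$ (at most one line per pair), carries an arbitrary reference orientation from $a$ to $b$, and has a susceptance interval $[s_e,t_e]$ with $0\le s_e\le t_e$ and a capacity $c_e\ge 0$. It is an LDC network if $s_e=t_e$ for all $e$. A \emph{classical flow} is a triple $(f,g,\ell)$ with $f_e\in\mathbb R$ for every line, generation $g_a\ge 0$ (zero off the generators) and load $\ell_a\ge 0$ (zero off the loads) at every node, such that $|f_e|\le c_e$ for every line and at every node $a$ the outgoing flow minus the incoming flow equals $g_a-\ell_a$. A \emph{solution} is a classical flow together with susceptances $b_e\in[s_e,t_e]$ and phase angles $\theta_a\in\mathbb R$ such that $f_{e}=b_{e}(\theta_{b}-\theta_{a})$ for every line $e$ oriented from $a$ to $b$. The maximum of $\sum_a g_a$ over all classical flows is the classical maximum flow $\mathrm{MF}(N)$; over all solutions it is the maximum FACTS flow $\mathrm{MFF}(N)$ (called the maximum potential flow $\mathrm{MPF}(N)$ if $N$ is an LDC network). The maximum switching flow of an LDC network is $\mathrm{MSF}(N)=\max_W \mathrm{MPF}(N-W)$,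 where $W$ ranges over the sets of lines and $N-W$ is $N$ with the lines in $W$ removed. Lemma. (1) The following problem is solvable in polynomial time (by a deterministic multi-tape Turing machine, in a number of steps polynomial in the length of the binary encoding of the instance): given an LDC network $N$ whose underlying graph is a tree, with rational data, and a rational $x\ge 0$, decide whether $\mathrm{MSF}(N)\ge x$. (2) The same holds for the problem: given a FACTS LDC network $N$ whose underlying graph is a tree, with rational data, and a rational $x\ge 0$, decide whether $\mathrm{MFF}(N)\ge x$. (3) Let $N$ be a FACTS LDC network with real data whose underlying graph has no cycles. Then for every choice of positive susceptances $b_e\in[s_e,t_e]$ and every classical flow $(f,g,\ell)$ (in particular every classical maximum flow) there are phase angles that turn it into a solution with these susceptances. The maxima defining $\mathrm{MF}(N)$, $\mathrm{MFF}(N)$ and, if $N$ is an LDC network, $\mathrm{MSF}(N)$ are attained. If $t_e>0$ for every line $e$, then $\mathrm{MFF}(N)=\mathrm{MF}(N)$, and if moreover $N$ is an LDC network, $\mathrm{MSF}(N)=\mathrm{MF}(N)$. -/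

import Mathlib

/-- A FACTS linear-DC power network with node type `V` and line type `E`.  Every line `e` carries an
(arbitrary) reference orientation from `src e` to `dst e`, a susceptance interval
`[susLo e, susHi e]` and a capacity `cap e`; no two lines join the same pair of nodes. -/
structure FactsNetwork (V E : Type*) where
  generators : Set V
  loads : Set V
  disjoint : Disjoint generators loads
  src : E → V
  dst : E → V
  src_ne_dst : ∀ e, src e ≠ dst e
  simple : ∀ e e', s(src e, dst e) = s(src e', dst e') → e = e'
  susLo : E → ℝ
  susHi : E → ℝ
  susLo_nonneg : ∀ e, 0 ≤ susLo e
  susLo_le_susHi : ∀ e, susLo e ≤ susHi e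
  cap : E → ℝ
  cap_nonneg : ∀ e, 0 ≤ cap e

namespace FactsNetwork

variable {V E : Type*}

/-- A linear-DC network: every susceptance is fixed. -/
def IsLDC (N : FactsNetwork V E) : Prop :=
  ∀ e, N.susLo e = N.susHi e

/-- The underlying undirected graph. -/
def graph (N : FactsNetwork V E) : SimpleGraph V where
  Adj a b := ∃ e, s(N.src e, N.dst e) = s(a, b)
  symm := ⟨fun a b ⟨e, he⟩ => ⟨e, by rw [he, Sym2.eq_swap]⟩⟩
  loopless := ⟨fun a ⟨e, he⟩ => N.src_ne_dst e (by
    rcases Sym2.eq_iff.1 he with ⟨h, h'⟩ | ⟨h, h'⟩ <;> rw [h, h'])⟩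

/-- The sub-network obtained by switching off the lines in `W`. -/
def remove (N : FactsNetwork V E) (W : Set E) : FactsNetwork V {e : E // e ∉ W} where
  generators := N.generators
  loads := N.loads
  disjoint := N.disjoint
  src e := N.src e
  dst e := N.dst e
  src_ne_dst e := N.src_ne_dst e
  simple e e' h := Subtype.ext (N.simple e e' h)
  susLo e := N.susLo e
  susHi e := N.susHi e
  susLo_nonneg e := N.susLo_nonneg e
  susLo_le_susHi e := N.susLo_le_susHi e
  cap e := N.cap e
  cap_nonneg e := N.cap_nonneg e

open Classical in
/-- Kirchhoff's conservation law for a flow `f`, generation `g` and load `l`. -/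
def Kirchhoff [Fintype E] (N : FactsNetwork V E) (f : E → ℝ) (g l : V → ℝ) : Prop :=
  ∀ a, (∑ e with N.src e = a, f e) - (∑ e with N.dst e = a, f e) = g a - l a

/-- The power law for susceptances `sus`, phase angles `θ` and a flow `f`. -/
def PowerLaw (N : FactsNetwork V E) (sus : E → ℝ) (θ : V → ℝ) (f : E → ℝ) : Prop :=
  ∀ e, f e = sus e * (θ (N.dst e) - θ (N.src e))

/-- A feasible flow in the traditional sense: generation takes place at generators only, load at
loads only, Kirchhoff's law holds and capacities are respected; there are no phase angles. -/
structure IsClassicalFlow [Fintype E] (N : FactsNetwork V E)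
    (f : E → ℝ) (g l : V → ℝ) : Prop where
  gen_nonneg : ∀ a, 0 ≤ g a
  gen_eq_zero : ∀ a, a ∉ N.generators → g a = 0
  load_nonneg : ∀ a, 0 ≤ l a
  load_eq_zero : ∀ a, a ∉ N.loads → l a = 0
  kirchhoff : N.Kirchhoff f g l
  abs_le_cap : ∀ e, |f e| ≤ N.cap e

/-- A solution of the network: a feasible flow that also obeys the power law for admissible
susceptances. -/
structure IsSolution [Fintype E] (N : FactsNetwork V E)
    (sus : E → ℝ) (θ : V → ℝ) (f : E → ℝ) (g l : V → ℝ) : Prop extends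
    N.IsClassicalFlow f g l where
  powerLaw : N.PowerLaw sus θ f
  sus_mem : ∀ e, sus e ∈ Set.Icc (N.susLo e) (N.susHi e)

/-- The total generations of all classical flows. -/
def classicalValues [Fintype V] [Fintype E] (N : FactsNetwork V E) : Set ℝ :=
  {r | ∃ f g l, N.IsClassicalFlow f g l ∧ ∑ a, g a = r}

/-- The total generations of all solutions. -/
def generationValues [Fintype V] [Fintype E] (N : FactsNetwork V E) : Set ℝ :=
  {r | ∃ sus θ f g l, N.IsSolution sus θ f g l ∧ ∑ a, g a = r}

/-- The total generations of all solutions of all switched sub-networks. -/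
def switchingValues [Fintype V] [Fintype E] (N : FactsNetwork V E) : Set ℝ :=
  open Classical in {r | ∃ W : Set E, r ∈ (N.remove W).generationValues}

/-- The traditional maximum flow. -/
noncomputable def maxFlow [Fintype V] [Fintype E] (N : FactsNetwork V E) : ℝ :=
  sSup N.classicalValues

/-- The maximum FACTS flow. -/
noncomputable def mff [Fintype V] [Fintype E] (N : FactsNetwork V E) : ℝ :=
  sSup N.generationValues

/-- The maximum potential flow of an LDC network (where the susceptances of a solution are forced
to be the fixed ones). -/
noncomputable def mpf [Fintype V] [Fintype E] (N : FactsNetwork V E) : ℝ :=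
  sSup N.generationValues

open Classical in
/-- The maximum switching flow of an LDC network. -/
noncomputable def msf [Fintype V] [Fintype E] (N : FactsNetwork V E) : ℝ :=
  ⨆ W : Set E, (N.remove W).mpf

end FactsNetwork

/-- The role of a node in a network given as input to a machine. -/
inductive NodeKind
  | generator
  | load
  | plain

/-- A line of a network given by rational data. -/
structure RatLine where
  src : ℕ
  dst : ℕ
  susLo : ℚ≥0
  susHi : ℚ≥0
  cap : ℚ≥0

/-- An instance of a decision problem: a network with rational data whose nodes are
`0, …, kinds.length - 1`, together with a threshold. -/
structure FlowInstance where
  kinds : List NodeKind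
  lines : List RatLine
  threshold : ℚ≥0
  src_lt : ∀ e ∈ lines, e.src < kinds.length
  dst_lt : ∀ e ∈ lines, e.dst < kinds.length
  src_ne_dst : ∀ e ∈ lines, e.src ≠ e.dst
  simple : (lines.map fun e => s(e.src, e.dst)).Nodup
  susLo_le_susHi : ∀ e ∈ lines, e.susLo ≤ e.susHi

namespace FlowInstance

/-- The network described by an instance. -/
def network (I : FlowInstance) : FactsNetwork (Fin I.kinds.length) (Fin I.lines.length) where
  generators := {v | I.kinds.get v = .generator}
  loads := {v | I.kinds.get v = .load}
  disjoint := Set.disjoint_left.2 fun v h h' => by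
    have h1 : I.kinds.get v = .generator := h
    have h2 : I.kinds.get v = .load := h'
    rw [h1] at h2
    cases h2
  src e := ⟨(I.lines.get e).src, I.src_lt _ (List.get_mem _ _)⟩
  dst e := ⟨(I.lines.get e).dst, I.dst_lt _ (List.get_mem _ _)⟩
  src_ne_dst e h := I.src_ne_dst _ (List.get_mem _ _) (congrArg Fin.val h)
  simple e e' h := by
    have h' := congrArg (Sym2.map Fin.val) h
    simp only [Sym2.map_mk] at h'
    have h2 : (I.lines.map fun e => s(e.src, e.dst))[e.1]'(by simp) =
        (I.lines.map fun e => s(e.src, e.dst))[e'.1]'(by simp) := by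
      simpa using h'
    exact Fin.ext ((List.Nodup.getElem_inj_iff I.simple).1 h2)
  susLo e := (I.lines.get e).susLo
  susHi e := (I.lines.get e).susHi
  susLo_nonneg e := NNRat.cast_nonneg _
  susLo_le_susHi e := NNRat.cast_le.2 (I.susLo_le_susHi _ (List.get_mem _ _))
  cap e := (I.lines.get e).cap
  cap_nonneg e := NNRat.cast_nonneg _

end FlowInstance

/-- Instances whose network is a tree. -/
def TreeFactsInstance : Type :=
  {I : FlowInstance // I.network.graph.IsTree}

/-- Instances whose network is a tree and has fixed susceptances. -/
def TreeLDCInstance : Type :=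
  {I : FlowInstance // I.network.graph.IsTree ∧ I.network.IsLDC}

open Classical in
/-- The decision version of the maximum FACTS flow problem on tree networks. -/
noncomputable def mffTreeProblem (I : TreeFactsInstance) : Bool :=
  decide ((I.1.threshold : ℝ) ≤ I.1.network.mff)

open Classical in
/-- The decision version of the maximum switching flow problem on tree networks. -/
noncomputable def msfTreeProblem (I : TreeLDCInstance) : Bool :=
  decide ((I.1.threshold : ℝ) ≤ I.1.network.msf)

namespace FlowEncoding

open Computability

/-- A natural number in binary (least significant bit first), closed by a comma. -/
def encNat (n : ℕ) : List Γ' :=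
  (encodeNat n).map Γ'.bit ++ [Γ'.comma]

/-- A non-negative rational: numerator and denominator in lowest terms. -/
def encRat (q : ℚ≥0) : List Γ' :=
  encNat q.num ++ encNat q.den

/-- A list: every entry is preceded by `bra`, and the list is closed by `ket`. -/
def encList {α : Type*} (f : α → List Γ') : List α → List Γ'
  | [] => [Γ'.ket]
  | x :: xs => Γ'.bra :: (f x ++ encList f xs)

def encKind : NodeKind → List Γ'
  | .generator => [Γ'.bit true, Γ'.bit false]
  | .load => [Γ'.bit false, Γ'.bit true]
  | .plain => [Γ'.bit false, Γ'.bit false]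

/-- A node: its name and its kind. -/
def encNode (p : NodeKind × ℕ) : List Γ' :=
  encNat p.2 ++ encKind p.1

/-- A line: the names of its ends, its susceptance limits and its capacity. -/
def encLine (e : RatLine) : List Γ' :=
  encNat e.src ++ (encNat e.dst ++ (encRat e.susLo ++ (encRat e.susHi ++ encRat e.cap)))

/-- An instance: the list of its nodes, the list of its lines, the threshold. -/
def encInstance (I : FlowInstance) : List Γ' :=
  encList encNode I.kinds.zipIdx ++ (encList encLine I.lines ++ encRat I.threshold)

/-! The encoding loses no information. -/

/-- `f` is injective and no code word is a proper prefix of another. -/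
def PrefixInj {α : Type*} (f : α → List Γ') : Prop :=
  ∀ x y r s, f x ++ r = f y ++ s → x = y ∧ r = s

theorem prefixInj_encNat : PrefixInj encNat := by
  have aux : ∀ (u v : List Bool) (r s : List Γ'),
      u.map Γ'.bit ++ Γ'.comma :: r = v.map Γ'.bit ++ Γ'.comma :: s → u = v ∧ r = s := by
    intro u
    induction u with
    | nil => intro v r s h; cases v <;> simp_all
    | cons b u ih =>
      intro v r s h
      cases v with
      | nil => simp at h
      | cons c v =>
        simp only [List.map_cons, List.cons_append, List.cons.injEq, Γ'.bit.injEq] at h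
        obtain ⟨h1, h2⟩ := ih v r s h.2
        exact ⟨by rw [h.1, h1], h2⟩
  intro x y r s h
  obtain ⟨h1, h2⟩ := aux (encodeNat x) (encodeNat y) r s (by simpa [encNat] using h)
  exact ⟨encodingNatBool.encode_injective h1, h2⟩

theorem prefixInj_encRat : PrefixInj encRat := by
  intro x y r s h
  simp only [encRat, List.append_assoc] at h
  obtain ⟨h1, h⟩ := prefixInj_encNat _ _ _ _ h
  obtain ⟨h2, h⟩ := prefixInj_encNat _ _ _ _ h
  exact ⟨NNRat.ext_num_den h1 h2, h⟩

theorem prefixInj_encList {α : Type*} {f : α → List Γ'} (hf : PrefixInj f) :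
    PrefixInj (encList f) := by
  intro x
  induction x with
  | nil => intro y r s h; cases y <;> simp_all [encList]
  | cons a x ih =>
    intro y r s h
    cases y with
    | nil => simp [encList] at h
    | cons b y =>
      simp only [encList, List.cons_append, List.append_assoc, List.cons.injEq, true_and] at h
      obtain ⟨h1, h⟩ := hf _ _ _ _ h
      obtain ⟨h2, h⟩ := ih _ _ _ h
      exact ⟨by rw [h1, h2], h⟩

theorem prefixInj_encNode : PrefixInj encNode := by
  rintro ⟨k, x⟩ ⟨k', y⟩ r s h
  simp only [encNode, List.append_assoc] at h
  obtain ⟨h1, h⟩ := prefixInj_encNat _ _ _ _ h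
  cases k <;> cases k' <;> simp_all [encKind]

theorem prefixInj_encLine : PrefixInj encLine := by
  rintro ⟨a, b, c, d, e⟩ ⟨a', b', c', d', e'⟩ r s h
  simp only [encLine, List.append_assoc] at h
  obtain ⟨h1, h⟩ := prefixInj_encNat _ _ _ _ h
  obtain ⟨h2, h⟩ := prefixInj_encNat _ _ _ _ h
  obtain ⟨h3, h⟩ := prefixInj_encRat _ _ _ _ h
  obtain ⟨h4, h⟩ := prefixInj_encRat _ _ _ _ h
  obtain ⟨h5, h⟩ := prefixInj_encRat _ _ _ _ h
  simp_all

theorem encInstance_injective : Function.Injective encInstance := by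
  intro I J h
  obtain ⟨h1, h⟩ := prefixInj_encList prefixInj_encNode _ _ _ _ h
  obtain ⟨h2, h⟩ := prefixInj_encList prefixInj_encLine _ _ _ _ h
  obtain ⟨h3, -⟩ := prefixInj_encRat _ _ [] [] (by simpa using h)
  have h1' : I.kinds = J.kinds := by
    simpa using congrArg (List.map Prod.fst) h1
  cases I
  cases J
  simp_all

end FlowEncoding

/-! Without cycles phase angles are no obstacle. Every line is a bridge, so angle differences can be
prescribed line by line (`exists_potential`), and a classical flow becomes a solution as soon as it
vanishes on the lines of susceptance zero. Hence the generation values of an acyclic network are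
those of the classical flows vanishing where `susHi` is zero (`generationValues_eq`). Extending
flows by zero over removed lines shows that switching gains nothing, so MSF equals MFF
(`msf_eq_mff`), and both equal MF if no upper susceptance limit vanishes. The maxima are attained
because the flows in question form a compact set (`isGreatest_zeroValues`).

Both decision problems thus ask for the classical maximum flow of a tree in which the lines with
`susHi` zero get capacity zero. It equals the minimum cut, which is computed by contracting leaves
into their parents (`treeCut`). One recursion along the tree yields a flow of that value
(`exists_flow`) and another a cut of that value (`exists_cut`); weak duality (`gen_le_cut`) closes
the gap. Multiplying the capacities by the product of their denominators keeps the computation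
within the natural numbers, and `dens_mul_mff` identifies the result.

For the running time, a small language of loops over four stacks is compiled into a multi-stack
machine, step for step (`Run.steps`). Its data are prefix codes of binary trees on top of the main
stack. The functions computable in this way in polynomial time (`PolyTime`) are closed under
composition, pairing, case distinction and folds with polynomially bounded accumulators. The
algorithm is a nest of such folds; the decisive bound is that a contraction at most doubles the
numbers in the table (`TableBound.contract`). -/

/-! ### A structured programming language for stack machines -/

namespace StackProgram

open Computability Turing

/-- The working stacks of a program: the main stack, two auxiliary stacks and a counter. -/
inductive Stk
  | main
  | left
  | right
  | counter
  deriving DecidableEq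

instance : Fintype Stk :=
  ⟨{.main, .left, .right, .counter}, fun k => by cases k <;> simp⟩

/-- The contents of the working stacks. -/
abbrev Store : Type := Stk → List Γ'

/-- Structured programs.  `loop k again body` pops a symbol `o` from `k` (`none` if the stack is
empty), runs `body o`, and starts again if `again o` holds. -/
inductive Cmd
  | skip
  | push (k : Stk) (s : Γ')
  | seq (c d : Cmd)
  | loop (k : Stk) (again : Option Γ' → Bool) (body : Option Γ' → Cmd)

/-- `Run c S S' t`: the program `c` turns the store `S` into `S'` in `t` steps. -/
inductive Run : Cmd → Store → Store → ℕ → Prop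
  | skip (S) : Run .skip S S 0
  | push (k s S) : Run (.push k s) S (Function.update S k (s :: S k)) 1
  | seq {c d S S' S'' t t'} : Run c S S' t → Run d S' S'' t' → Run (.seq c d) S S'' (t + t')
  | exit {k again body S S' t} : again (S k).head? = false →
      Run (body (S k).head?) (Function.update S k (S k).tail) S' t →
      Run (.loop k again body) S S' (t + 1)
  | again {k again body S S' S'' t t'} : again (S k).head? = true →
      Run (body (S k).head?) (Function.update S k (S k).tail) S' t →
      Run (.loop k again body) S' S'' t' →
      Run (.loop k again body) S S'' (t' + t + 1)

/-- Each step makes a stack at most one symbol longer. -/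
theorem Run.length_le {c : Cmd} {S S' : Store} {t : ℕ} (h : Run c S S' t) (k : Stk) :
    (S' k).length ≤ (S k).length + t := by
  induction h with
  | skip => simp
  | push k' s S =>
    by_cases hk : k = k'
    · subst hk; simp
    · simp [hk]
  | seq _ _ h1 h2 => omega
  | @exit k' _ _ S _ _ _ _ h1 =>
    by_cases hk : k = k'
    · subst hk; simp at h1; omega
    · simp [hk] at h1; omega
  | @again k' _ _ S _ _ _ _ _ _ _ h1 h2 =>
    by_cases hk : k = k'
    · subst hk; simp at h1; omega
    · simp [hk] at h1; omega

/-! #### Compilation -/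

/-- The labels of the compiled program. -/
def Cmd.Lab : Cmd → Type
  | .skip => Empty
  | .push _ _ => Unit
  | .seq c d => c.Lab ⊕ d.Lab
  | .loop _ _ body => Option (Σ o, (body o).Lab)

theorem Cmd.finite_lab : ∀ c : Cmd, Finite c.Lab
  | .skip => inferInstanceAs (Finite Empty)
  | .push _ _ => inferInstanceAs (Finite Unit)
  | .seq c d => by
    have := c.finite_lab
    have := d.finite_lab
    exact inferInstanceAs (Finite (c.Lab ⊕ d.Lab))
  | .loop _ _ body => by
    have := fun o => (body o).finite_lab
    exact inferInstanceAs (Finite (Option (Σ o, (body o).Lab)))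

/-- The stacks of the compiled machine: the working stacks and an output stack (`none`). -/
abbrev Alphabet : Option Stk → Type
  | none => Bool
  | some _ => Γ'

section

variable {Λ : Type}

/-- The first label of a program, where `emb` embeds its labels and `exit` is executed next. -/
def Cmd.entry : (c : Cmd) → (c.Lab → Λ) → Λ → Λ
  | .skip, _, exit => exit
  | .push _ _, emb, _ => emb ()
  | .seq c d, emb, exit => c.entry (fun l => emb (.inl l)) (d.entry (fun l => emb (.inr l)) exit)
  | .loop _ _ _, emb, _ => emb none

/-- The code at the labels of a program. -/
def Cmd.stmt : (c : Cmd) → (c.Lab → Λ) → Λ → c.Lab → TM2.Stmt Alphabet Λ (Option Γ')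
  | .skip, _, _, l => nomatch l
  | .push k s, _, exit, _ => .push (some k) (fun _ => s) (.goto fun _ => exit)
  | .seq c d, emb, exit, .inl l =>
    c.stmt (fun l => emb (.inl l)) (d.entry (fun l => emb (.inr l)) exit) l
  | .seq _ d, emb, exit, .inr l => d.stmt (fun l => emb (.inr l)) exit l
  | .loop k again body, emb, exit, none =>
    .pop (some k) (fun _ o => o) (.goto fun o =>
      -- The popped symbol is part of the labels of the body, so whether to repeat is already
      -- decided when the body is compiled.
      (body o).entry (fun l => emb (some ⟨o, l⟩)) (if again o then emb none else exit))
  | .loop _ again body, emb, exit, some ⟨o, l⟩ =>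
    (body o).stmt (fun l => emb (some ⟨o, l⟩)) (if again o then emb none else exit) l

/-- The stacks of the machine with given working stacks and an empty output stack. -/
def Store.lift (S : Store) : (k : Option Stk) → List (Alphabet k)
  | none => []
  | some k => S k

theorem Store.update_lift (S : Store) (k : Stk) (w : List Γ') :
    Function.update S.lift (some k) w = Store.lift (Function.update S k w) := by
  funext k'
  cases k' with
  | none => rfl
  | some k' =>
    by_cases h : k' = k
    · subst h; simp only [Function.update_self, Store.lift]
    · rw [Function.update_of_ne (by simpa using h)]
      simp [Store.lift, h]

/-- The machine `M` gets from one configuration to the other in `t` steps. -/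
def Steps (M : Λ → TM2.Stmt Alphabet Λ (Option Γ')) (t : ℕ)
    (x y : TM2.Cfg Alphabet Λ (Option Γ')) : Prop :=
  (flip bind (TM2.step M))^[t] (some x) = some y

theorem Steps.trans {M : Λ → TM2.Stmt Alphabet Λ (Option Γ')} {t t' : ℕ}
    {x y z : TM2.Cfg Alphabet Λ (Option Γ')} (h : Steps M t x y) (h' : Steps M t' y z) :
    Steps M (t' + t) x z := by
  unfold Steps at *
  rw [Function.iterate_add_apply, h, h']

theorem Steps.head {M : Λ → TM2.Stmt Alphabet Λ (Option Γ')} {t : ℕ}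
    {x y z : TM2.Cfg Alphabet Λ (Option Γ')} (h : TM2.step M x = some y) (h' : Steps M t y z) :
    Steps M (t + 1) x z :=
  Steps.trans (t := 1) h h'

theorem Steps.single {M : Λ → TM2.Stmt Alphabet Λ (Option Γ')}
    {x y : TM2.Cfg Alphabet Λ (Option Γ')} (h : TM2.step M x = some y) : Steps M 1 x y :=
  h

/-- Sequencing costs nothing since the code of `c` jumps straight to the entry of `d`; a push and
the pop that heads a loop round cost one machine step each, so the two step counts agree exactly.
The embedding and the exit label are universally quantified so that the induction hypothesis applies
to subprograms placed inside a larger machine. -/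
theorem Run.steps {c : Cmd} {S S' : Store} {t : ℕ} (h : Run c S S' t)
    (M : Λ → TM2.Stmt Alphabet Λ (Option Γ')) :
    ∀ (emb : c.Lab → Λ) (exit : Λ), (∀ l, M (emb l) = c.stmt emb exit l) → ∀ v, ∃ v',
      Steps M t ⟨some (c.entry emb exit), v, S.lift⟩ ⟨some exit, v', S'.lift⟩ := by
  induction h with
  | skip S => exact fun emb exit _ v => ⟨v, rfl⟩
  | push k s S =>
    intro emb exit hM v
    refine ⟨v, ?_⟩
    simp only [Steps, Function.iterate_one, flip, Cmd.entry]
    rw [← Store.update_lift]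
    simp only [Option.bind_eq_bind, Option.bind_some, TM2.step, hM ()]
    rfl
  | seq _ _ h1 h2 =>
    intro emb exit hM v
    obtain ⟨v1, h1⟩ := h1 _ _ (fun l => hM (.inl l)) v
    obtain ⟨v2, h2⟩ := h2 _ _ (fun l => hM (.inr l)) v1
    refine ⟨v2, ?_⟩
    rw [add_comm]
    exact h1.trans h2
  | @exit k again body S S' t hg _ h1 =>
    intro emb exit hM v
    obtain ⟨v1, h1⟩ := h1 (fun l => emb (some ⟨_, l⟩)) _ (fun l => hM (some ⟨_, l⟩))
      (S k).head?
    refine ⟨v1, Steps.head ?_ (by simpa only [hg, Bool.false_eq_true, if_false] using h1)⟩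
    simp only [TM2.step, Cmd.entry, hM none]
    rw [← Store.update_lift]
    simp [Cmd.stmt, TM2.stepAux, Store.lift, hg]
  | @again k again body S S' S'' t t' hg _ _ h1 h2 =>
    intro emb exit hM v
    obtain ⟨v1, h1⟩ := h1 (fun l => emb (some ⟨_, l⟩)) _ (fun l => hM (some ⟨_, l⟩))
      (S k).head?
    obtain ⟨v2, h2⟩ := h2 emb exit hM v1
    simp only [hg, if_true] at h1
    refine ⟨v2, Steps.head ?_ (h1.trans h2)⟩
    simp only [TM2.step, Cmd.entry, hM none]
    rw [← Store.update_lift]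
    simp [Cmd.stmt, TM2.stepAux, Store.lift, hg]

end

/-- The bit carried by a symbol. -/
def symbolBit : Option Γ' → Bool
  | some (.bit b) => b
  | _ => false

open Classical in
/-- The machine that runs `c` on its input and outputs the bit on top of the main stack. -/
noncomputable def Cmd.machine (c : Cmd) : FinTM2 where
  K := Option Stk
  k₀ := some .main
  k₁ := none
  Γ := Alphabet
  Λ := Option c.Lab
  main := c.entry some none
  ΛFin := have := c.finite_lab; Fintype.ofFinite _
  σ := Option Γ'
  initialState := none
  Γk₀Fin := inferInstanceAs (Fintype Γ')
  m
    | some l => c.stmt some none l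
    -- A halting configuration must carry the initial internal state, hence the `load` before
    -- halting.
    | none => .pop (some .main) (fun _ o => o) (.push none symbolBit (.load (fun _ => none) .halt))

/-- The store with given main stack, the other stacks being empty. -/
def Store.init (w : List Γ') : Store
  | .main => w
  | _ => []

/-- Programs that run in polynomial time give rise to polynomial time machines. -/
theorem computableInPolyTime {α : Type} (e : α → List Γ') (f : α → Bool) (c : Cmd)
    (p : Polynomial ℕ)
    (h : ∀ a, ∃ t ≤ p.eval (e a).length,
      Run c (Store.init (e a)) (Store.init [.bit (f a)]) t) :
    Nonempty (TM2ComputableInPolyTime e encodeBool f) := by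
  classical
  choose t ht hr using h
  -- The additional step is the one at label `none`, which moves the answer to the output stack.
  refine ⟨⟨⟨c.machine, Equiv.refl _, Equiv.refl _⟩, p + 1, fun a => ⟨⟨t a + 1, ?_⟩, ?_⟩⟩⟩
  · obtain ⟨v, hv⟩ := (hr a).steps c.machine.m some none (fun l => rfl) none
    have hfin : TM2.step c.machine.m ⟨some none, v, (Store.init [.bit (f a)]).lift⟩ =
        some (haltList c.machine (encodeBool (f a))) := by
      simp only [TM2.step, Cmd.machine, TM2.stepAux, haltList]
      congr 1
      congr 1
      funext k
      rcases k with _ | k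
      · simp [Store.lift, encodeBool, symbolBit, Store.init]; rfl
      · cases k <;> simp [Function.update, Store.lift, Store.init]
    have h2 := hv.trans (Steps.single hfin)
    have hinit : initList c.machine (e a) =
        ⟨some (c.entry some none), none, (Store.init (e a)).lift⟩ := by
      simp only [initList, Cmd.machine]
      congr 1
      funext k
      rcases k with _ | k
      · simp [Store.lift]
      · cases k
        · simp [Store.lift, Store.init]; rfl
        all_goals simp [Store.lift, Store.init]
    rw [add_comm] at h2
    have e1 : List.map (Equiv.refl Γ').invFun (e a) = e a := List.map_id _
    have e2 : List.map (Equiv.refl Bool).invFun (encodeBool (f a)) = encodeBool (f a) :=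
      List.map_id _
    exact ((congrArg (fun x => (flip bind c.machine.step)^[t a + 1] (some (initList c.machine x)))
      e1).trans ((congrArg (fun x => (flip bind c.machine.step)^[t a + 1] (some x)) hinit).trans
      h2)).trans (congrArg (fun x => some (haltList c.machine x)) e2).symm
  · simpa using ht a

end StackProgram

/-! ### Programs on words that code trees -/

namespace StackProgram

open Computability Turing

/-- The store with the given stacks. -/
def st (M A B C : List Γ') : Store
  | .main => M
  | .left => A
  | .right => B
  | .counter => C

section

variable (M A B C w : List Γ')

@[simp] theorem st_main : st M A B C .main = M := rfl
@[simp] theorem st_left : st M A B C .left = A := rfl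
@[simp] theorem st_right : st M A B C .right = B := rfl
@[simp] theorem st_counter : st M A B C .counter = C := rfl

@[simp] theorem update_st_main : Function.update (st M A B C) .main w = st w A B C := by
  funext k; cases k <;> rfl

@[simp] theorem update_st_left : Function.update (st M A B C) .left w = st M w B C := by
  funext k; cases k <;> rfl

@[simp] theorem update_st_right : Function.update (st M A B C) .right w = st M A w C := by
  funext k; cases k <;> rfl

@[simp] theorem update_st_counter : Function.update (st M A B C) .counter w = st M A B w := by
  funext k; cases k <;> rfl

theorem st_init : Store.init w = st w [] [] [] := by
  funext k; cases k <;> rfl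

end

/-- `Exec c S S' n`: the program `c` turns `S` into `S'` in at most `n` steps. -/
def Exec (c : Cmd) (S S' : Store) (n : ℕ) : Prop :=
  ∃ t ≤ n, Run c S S' t

theorem Exec.mono {c : Cmd} {S S' : Store} {n m : ℕ} (h : Exec c S S' n) (hnm : n ≤ m) :
    Exec c S S' m :=
  let ⟨t, ht, hr⟩ := h
  ⟨t, ht.trans hnm, hr⟩

theorem Exec.skip (S : Store) : Exec .skip S S 0 :=
  ⟨0, le_rfl, .skip S⟩

theorem Exec.seq {c d : Cmd} {S S' S'' : Store} {n m : ℕ} (h : Exec c S S' n)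
    (h' : Exec d S' S'' m) : Exec (.seq c d) S S'' (n + m) :=
  let ⟨_, ht, hr⟩ := h
  let ⟨_, ht', hr'⟩ := h'
  ⟨_, add_le_add ht ht', hr.seq hr'⟩

theorem Exec.push (k : Stk) (s : Γ') (S : Store) :
    Exec (.push k s) S (Function.update S k (s :: S k)) 1 :=
  ⟨1, le_rfl, .push k s S⟩

theorem Exec.exit {k : Stk} {again : Option Γ' → Bool} {body : Option Γ' → Cmd} {S S' : Store}
    {n : ℕ} (hg : again (S k).head? = false)
    (h : Exec (body (S k).head?) (Function.update S k (S k).tail) S' n) :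
    Exec (.loop k again body) S S' (n + 1) :=
  let ⟨_, ht, hr⟩ := h
  ⟨_, Nat.add_le_add_right ht 1, hr.exit hg⟩

theorem Exec.again {k : Stk} {again : Option Γ' → Bool} {body : Option Γ' → Cmd}
    {S S' S'' : Store} {n m : ℕ} (hg : again (S k).head? = true)
    (h : Exec (body (S k).head?) (Function.update S k (S k).tail) S' n)
    (h' : Exec (.loop k again body) S' S'' m) :
    Exec (.loop k again body) S S'' (m + n + 1) :=
  let ⟨_, ht, hr⟩ := h
  let ⟨_, ht', hr'⟩ := h'
  ⟨_, by omega, hr.again hg hr'⟩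

/-- Pop a symbol and branch. -/
def pop (k : Stk) (body : Option Γ' → Cmd) : Cmd :=
  .loop k (fun _ => false) body

theorem Exec.pop {k : Stk} {body : Option Γ' → Cmd} {S S' : Store} {n : ℕ}
    (h : Exec (body (S k).head?) (Function.update S k (S k).tail) S' n) :
    Exec (pop k body) S S' (n + 1) :=
  Exec.exit rfl h

/-! #### Trees -/

/-- Binary trees whose leaves carry bits. -/
inductive Tree
  | leaf (b : Bool)
  | node (x y : Tree)

/-- The prefix code of a tree. -/
def Tree.code : Tree → List Γ'
  | .leaf b => [.bit b]
  | .node x y => .bra :: (x.code ++ y.code)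

/-- This leaves the comma free to mark the bottom of a tree stored on an auxiliary stack. -/
theorem Tree.comma_notMem_code (x : Tree) : Γ'.comma ∉ x.code := by
  induction x with
  | leaf b => simp [code]
  | node x y hx hy => simp [code, hx, hy]

/-- Push a symbol if a flag is set. -/
def pushIf (b : Bool) (k : Stk) (s : Γ') : Cmd :=
  bif b then .push k s else .skip

/-- The word `w` moved to a stack symbol by symbol, if a flag is set. -/
def stash (b : Bool) (w A : List Γ') : List Γ' :=
  bif b then w.reverse ++ A else A

theorem stash_append (b : Bool) (v w A : List Γ') :
    stash b (v ++ w) A = stash b w (stash b v A) := by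
  cases b <;> simp [stash]

theorem stash_cons (b : Bool) (s : Γ') (w A : List Γ') :
    stash b (s :: w) A = stash b w (stash b [s] A) := by
  cases b <;> simp [stash]

theorem exec_pushIf_left (b : Bool) (s : Γ') (M A B C : List Γ') :
    Exec (pushIf b .left s) (st M A B C) (st M (stash b [s] A) B C) 1 := by
  cases b
  · exact (Exec.skip _).mono (by simp)
  · simpa [stash, pushIf] using Exec.push .left s (st M A B C)

theorem exec_pushIf_right (b : Bool) (s : Γ') (M A B C : List Γ') :
    Exec (pushIf b .right s) (st M A B C) (st M A (stash b [s] B) C) 1 := by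
  cases b
  · exact (Exec.skip _).mono (by simp)
  · simpa [stash, pushIf] using Exec.push .right s (st M A B C)

/-- Copy a symbol to the selected auxiliary stacks. -/
def emit (b b' : Bool) (s : Γ') : Cmd :=
  .seq (pushIf b .left s) (pushIf b' .right s)

theorem exec_emit (b b' : Bool) (s : Γ') (M A B C : List Γ') :
    Exec (emit b b' s) (st M A B C) (st M (stash b [s] A) (stash b' [s] B) C) 2 :=
  (exec_pushIf_left b s M A B C).seq (exec_pushIf_right b' s _ _ _ _)

/-- Move as many trees from the main stack as the counter tells. -/
def scan (b b' : Bool) : Cmd :=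
  .loop .counter (fun o => o == some .bra) fun o => match o with
    | some .bra => pop .main fun o => match o with
      | some .bra => .seq (emit b b' .bra) (.seq (.push .counter .bra) (.push .counter .bra))
      | some s => emit b b' s
      | none => .skip
    | _ => .skip

/-- The counter holds one `bra` per tree still to be read: a `bra` on the main stack replaces one
pending tree by two, a bit completes one. The loop does not pause between subtrees, so the claim is
stated with an arbitrary continuation ending in `S`. A symbol costs at most two pops, two copies and
two pushes on the counter. -/
theorem exec_scan (b b' : Bool) (x : Tree) : ∀ (M A B C : List Γ') (S : Store) (n : ℕ),
    Exec (scan b b') (st M (stash b x.code A) (stash b' x.code B) C) S n →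
    Exec (scan b b') (st (x.code ++ M) A B (.bra :: C)) S (n + 6 * x.code.length) := by
  induction x with
  | leaf c =>
    intro M A B C S n h
    refine (Exec.again (by simp) (Exec.pop ?_) h).mono (m := n + 6 * 1)
      (show n + (2 + 1) + 1 ≤ n + 6 * 1 by omega)
    simpa [Tree.code] using exec_emit b b' (.bit c) M A B C
  | node x y hx hy =>
    intro M A B C S n h
    have h2 := hx (y.code ++ M) (stash b [.bra] A) (stash b' [.bra] B) (.bra :: C) S
      (n + 6 * y.code.length) (hy _ _ _ _ _ _ (by
        rw [Tree.code, stash_cons, stash_cons b', stash_append, stash_append] at h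
        exact h))
    refine (Exec.again (by simp) (Exec.pop (n := 4) ?_) h2).mono ?_
    · have h3 := (exec_emit b b' .bra (x.code ++ (y.code ++ M)) A B C).seq
        ((Exec.push .counter .bra _).seq (Exec.push .counter .bra _))
      simpa [Tree.code] using h3
    · simp [Tree.code]; omega

/-- Move the tree on top of the main stack to the selected auxiliary stacks. -/
def take (b b' : Bool) : Cmd :=
  .seq (emit b b' .comma) (.seq (.push .counter .comma) (.seq (.push .counter .bra) (scan b b')))

/-- The comma pushed on the counter stops the scan and protects what lies below it. -/
theorem exec_take (b b' : Bool) (x : Tree) (M A B C : List Γ') :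
    Exec (take b b') (st (x.code ++ M) A B C)
      (st M (stash b (.comma :: x.code) A) (stash b' (.comma :: x.code) B) C)
      (6 * x.code.length + 5) := by
  have h0 : Exec (scan b b') (st M (stash b (.comma :: x.code) A)
      (stash b' (.comma :: x.code) B) (.comma :: C))
      (st M (stash b (.comma :: x.code) A) (stash b' (.comma :: x.code) B) C) 1 :=
    Exec.exit (n := 0) (by simp) (by simpa using Exec.skip _)
  rw [stash_cons, stash_cons b'] at h0 ⊢
  have h1 := exec_scan b b' x _ _ _ _ _ _ h0
  have h2 := (exec_emit b b' .comma (x.code ++ M) A B C).seq ((Exec.push .counter .comma _).seq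
    ((Exec.push .counter .bra _).seq (by simpa using h1)))
  exact h2.mono (by omega)

/-- Move a word from an auxiliary stack back to the main stack. -/
def put (k : Stk) : Cmd :=
  .loop k (fun o => o.isSome && !(o == some .comma)) fun o => match o with
    | some .comma => .skip
    | some s => .push .main s
    | none => .skip

theorem exec_put_left (w : List Γ') : ∀ (M A B C : List Γ'), Γ'.comma ∉ w →
    Exec (put .left) (st M (w ++ .comma :: A) B C) (st (w.reverse ++ M) A B C)
      (2 * w.length + 1) := by
  induction w with
  | nil =>
    intro M A B C _
    exact Exec.exit (n := 0) (by simp) (by simpa using Exec.skip _)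
  | cons s w ih =>
    intro M A B C hs
    simp only [List.mem_cons, not_or] at hs
    have h1 := ih (s :: M) A B C hs.2
    refine (Exec.again (S' := st (s :: M) (w ++ .comma :: A) B C) (n := 1) ?_ ?_
      (by rw [List.reverse_cons, List.append_assoc]; exact h1)).mono ?_
    · simpa using fun h => hs.1 h.symm
    · have h2 := Exec.push .main s (st M (w ++ .comma :: A) B C)
      cases s <;> simp_all
    · simp only [List.length_cons]; omega

theorem exec_put_right (w : List Γ') : ∀ (M A B C : List Γ'), Γ'.comma ∉ w →
    Exec (put .right) (st M A (w ++ .comma :: B) C) (st (w.reverse ++ M) A B C)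
      (2 * w.length + 1) := by
  induction w with
  | nil =>
    intro M A B C _
    exact Exec.exit (n := 0) (by simp) (by simpa using Exec.skip _)
  | cons s w ih =>
    intro M A B C hs
    simp only [List.mem_cons, not_or] at hs
    have h1 := ih (s :: M) A B C hs.2
    refine (Exec.again (S' := st (s :: M) A (w ++ .comma :: B) C) (n := 1) ?_ ?_
      (by rw [List.reverse_cons, List.append_assoc]; exact h1)).mono ?_
    · simpa using fun h => hs.1 h.symm
    · have h2 := Exec.push .main s (st M A (w ++ .comma :: B) C)
      cases s <;> simp_all
    · simp only [List.length_cons]; omega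

/-- Moving a word between stacks reverses it; `take` and `put` together reverse it twice. -/
theorem exec_restore_left (x : Tree) (M A B C : List Γ') :
    Exec (put .left) (st M (stash true (.comma :: x.code) A) B C) (st (x.code ++ M) A B C)
      (2 * x.code.length + 1) := by
  have h := exec_put_left x.code.reverse M A B C (by simpa using x.comma_notMem_code)
  simpa [stash] using h

theorem exec_restore_right (x : Tree) (M A B C : List Γ') :
    Exec (put .right) (st M A (stash true (.comma :: x.code) B) C) (st (x.code ++ M) A B C)
      (2 * x.code.length + 1) := by
  have h := exec_put_right x.code.reverse M A B C (by simpa using x.comma_notMem_code)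
  simpa [stash] using h

/-- Duplicate the tree on top of the main stack. -/
def dup : Cmd :=
  .seq (take true true) (.seq (put .left) (put .right))

theorem exec_dup (x : Tree) (M A B C : List Γ') :
    Exec dup (st (x.code ++ M) A B C) (st (x.code ++ (x.code ++ M)) A B C)
      (10 * x.code.length + 7) :=
  ((exec_take true true x M A B C).seq ((exec_restore_left x _ _ _ _).seq
    (exec_restore_right x _ _ _ _))).mono (by omega)

/-- Remove the tree on top of the main stack. -/
def drop : Cmd :=
  take false false

theorem exec_drop (x : Tree) (M A B C : List Γ') :
    Exec drop (st (x.code ++ M) A B C) (st M A B C) (6 * x.code.length + 5) :=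
  exec_take false false x M A B C

/-- Exchange the two trees on top of the main stack. -/
def swap : Cmd :=
  .seq (take true false) (.seq (take false true) (.seq (put .left) (put .right)))

theorem exec_swap (x y : Tree) (M A B C : List Γ') :
    Exec swap (st (x.code ++ (y.code ++ M)) A B C) (st (y.code ++ (x.code ++ M)) A B C)
      (8 * x.code.length + 8 * y.code.length + 12) :=
  ((exec_take true false x _ A B C).seq ((exec_take false true y _ _ _ _).seq
    ((exec_restore_left x _ _ _ _).seq (exec_restore_right y _ _ _ _)))).mono (by omega)

/-- Push a word so that its first symbol is on top. -/
def pushWord : List Γ' → Cmd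
  | [] => .skip
  | s :: w => .seq (pushWord w) (.push .main s)

theorem exec_pushWord (w M A B C : List Γ') :
    Exec (pushWord w) (st M A B C) (st (w ++ M) A B C) w.length := by
  induction w with
  | nil => exact Exec.skip _
  | cons s w ih =>
    have h := ih.seq (Exec.push .main s _)
    rwa [st_main, update_st_main] at h

end StackProgram

/-! ### Functions computable in polynomial time on tree codes -/

namespace StackProgram

open Computability Turing

/-- A representation of the elements of a type by trees. -/
class TreeCode (α : Type) where
  tree : α → Tree

open TreeCode

/-- The code word of an element. -/
def word {α : Type} [TreeCode α] (a : α) : List Γ' :=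
  (tree a).code

/-- The length of the code word of an element. -/
def size {α : Type} [TreeCode α] (a : α) : ℕ :=
  (word a).length

instance : TreeCode Bool := ⟨.leaf⟩

instance {α β : Type} [TreeCode α] [TreeCode β] : TreeCode (α × β) :=
  ⟨fun p => .node (tree p.1) (tree p.2)⟩

/-- The tree of a list. -/
def listTree {α : Type} [TreeCode α] : List α → Tree
  | [] => .leaf false
  | a :: l => .node (tree a) (listTree l)

instance {α : Type} [TreeCode α] : TreeCode (List α) := ⟨listTree⟩

section

variable {α β : Type} [TreeCode α] [TreeCode β]

theorem word_bool (b : Bool) : word b = [.bit b] := rfl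

theorem word_pair (p : α × β) : word p = .bra :: (word p.1 ++ word p.2) := rfl

theorem word_nil : word ([] : List α) = [.bit false] := rfl

theorem word_cons (a : α) (l : List α) : word (a :: l) = .bra :: (word a ++ word l) := rfl

@[simp] theorem size_bool (b : Bool) : size b = 1 := rfl

@[simp] theorem size_pair (p : α × β) : size p = size p.1 + size p.2 + 1 := by
  simp [size, word_pair]

@[simp] theorem size_nil : size ([] : List α) = 1 := rfl

@[simp] theorem size_cons (a : α) (l : List α) : size (a :: l) = size a + size l + 1 := by
  simp [size, word_cons]

theorem length_lt_size (l : List α) : l.length < size l := by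
  induction l with
  | nil => simp
  | cons a l ih => simp; omega

theorem size_le_of_mem {l : List α} {a : α} (h : a ∈ l) : size a < size l := by
  induction l with
  | nil => simp at h
  | cons b l ih =>
    rcases List.mem_cons.1 h with rfl | h
    · simp
    · have := ih h
      simp; omega

theorem size_list_le {l : List α} {k : ℕ} (h : ∀ a ∈ l, size a ≤ k) :
    size l ≤ l.length * (k + 1) + 1 := by
  induction l with
  | nil => simp
  | cons a l ih =>
    have h1 := h a (by simp)
    have h2 := ih fun b hb => h b (by simp [hb])
    simp only [size_cons, List.length_cons]
    nlinarith

end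

section

variable {α β : Type} [TreeCode α] [TreeCode β] (a : α) (b : β) (M A B C : List Γ')

theorem exec_dup_word : Exec dup (st (word a ++ M) A B C) (st (word a ++ (word a ++ M)) A B C)
    (10 * size a + 7) :=
  exec_dup (tree a) M A B C

theorem exec_drop_word : Exec drop (st (word a ++ M) A B C) (st M A B C) (6 * size a + 5) :=
  exec_drop (tree a) M A B C

theorem exec_swap_word : Exec swap (st (word a ++ (word b ++ M)) A B C)
    (st (word b ++ (word a ++ M)) A B C) (8 * size a + 8 * size b + 12) :=
  exec_swap (tree a) (tree b) M A B C

theorem exec_push_main (s : Γ') : Exec (.push .main s) (st M A B C) (st (s :: M) A B C) 1 := by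
  simpa using Exec.push .main s (st M A B C)

theorem exec_bra_word : Exec (.push .main .bra) (st (word a ++ (word b ++ M)) A B C)
    (st (word (a, b) ++ M) A B C) 1 := by
  simpa [word_pair] using exec_push_main (word a ++ (word b ++ M)) A B C .bra

end

/-! #### Polynomially bounded functions -/

theorem eval_mono (p : Polynomial ℕ) : Monotone fun n => p.eval n := by
  induction p using Polynomial.induction_on' with
  | add p q hp hq => simpa using hp.add hq
  | monomial n a =>
    intro x y h
    simpa using Nat.mul_le_mul_left a (Nat.pow_le_pow_left h n)

/-- `g` is bounded by a polynomial in the size of its argument. -/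
def PolyBdd {α : Type} [TreeCode α] (g : α → ℕ) : Prop :=
  ∃ p : Polynomial ℕ, ∀ a, g a ≤ p.eval (size a)

namespace PolyBdd

variable {α : Type} [TreeCode α] {g h : α → ℕ}

theorem const (n : ℕ) : PolyBdd fun _ : α => n :=
  ⟨.C n, fun a => by simp⟩

theorem size : PolyBdd fun a : α => StackProgram.size a :=
  ⟨.X, fun a => by simp⟩

theorem mono (hg : PolyBdd g) (hle : ∀ a, h a ≤ g a) : PolyBdd h :=
  let ⟨p, hp⟩ := hg
  ⟨p, fun a => (hle a).trans (hp a)⟩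

theorem add (hg : PolyBdd g) (hh : PolyBdd h) : PolyBdd fun a => g a + h a :=
  let ⟨p, hp⟩ := hg
  let ⟨q, hq⟩ := hh
  ⟨p + q, fun a => by simpa using add_le_add (hp a) (hq a)⟩

theorem mul (hg : PolyBdd g) (hh : PolyBdd h) : PolyBdd fun a => g a * h a :=
  let ⟨p, hp⟩ := hg
  let ⟨q, hq⟩ := hh
  ⟨p * q, fun a => by simpa using Nat.mul_le_mul (hp a) (hq a)⟩

theorem eval (p : Polynomial ℕ) (hg : PolyBdd g) : PolyBdd fun a => p.eval (g a) :=
  let ⟨q, hq⟩ := hg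
  ⟨p.comp q, fun a => by simpa using eval_mono p (hq a)⟩

theorem comp {β : Type} [TreeCode β] {g : β → ℕ} {f : α → β} (hg : PolyBdd g)
    (hf : PolyBdd fun a => StackProgram.size (f a)) : PolyBdd fun a => g (f a) :=
  let ⟨p, hp⟩ := hg
  (eval p hf).mono fun a => hp (f a)

end PolyBdd

/-! #### Polynomial time computable functions -/

/-- `f` is computed in polynomial time by a program that works on the top of the main stack. -/
def PolyTime {α β : Type} [TreeCode α] [TreeCode β] (f : α → β) : Prop :=
  ∃ (c : Cmd) (g : α → ℕ), PolyBdd g ∧ ∀ a M A B C,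
    Exec c (st (word a ++ M) A B C) (st (word (f a) ++ M) A B C) (g a)

namespace PolyTime

variable {α β γ δ : Type} [TreeCode α] [TreeCode β] [TreeCode γ] [TreeCode δ]

/-- Each step adds at most one symbol, so the running time also bounds the growth of the output.
This is what keeps compositions polynomial. -/
theorem polyBdd_size {f : α → β} (hf : PolyTime f) : PolyBdd fun a => size (f a) := by
  obtain ⟨c, g, hg, h⟩ := hf
  refine (PolyBdd.size.add hg).mono fun a => ?_
  obtain ⟨t, ht, hr⟩ := h a [] [] [] []
  have := hr.length_le .main
  simp only [st_main, List.append_nil] at this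
  exact this.trans (Nat.add_le_add_left ht _)

theorem comp {f : β → γ} {g : α → β} (hf : PolyTime f) (hg : PolyTime g) : PolyTime fun a => f (g a) := by
  obtain ⟨c, k, hk, h⟩ := id hg
  obtain ⟨c', k', hk', h'⟩ := hf
  exact ⟨.seq c c', _, hk.add (hk'.comp hg.polyBdd_size), fun a M A B C =>
    (h a M A B C).seq (h' (g a) M A B C)⟩

theorem id : PolyTime fun a : α => a :=
  ⟨.skip, _, .const 0, fun _ _ _ _ _ => Exec.skip _⟩

theorem const (b : β) : PolyTime fun _ : α => b :=
  ⟨.seq drop (pushWord (word b)), _,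
    (((PolyBdd.const 6).mul .size).add (.const 5)).add (.const (word b).length),
    fun a M A B C => (exec_drop (tree a) M A B C).seq (exec_pushWord (word b) M A B C)⟩

/-- The stack serves as a postfix calculator. The second component is computed first, on one copy of
the argument; this is possible because programs leave whatever lies below their argument intact. -/
theorem pair {f : α → β} {g : α → γ} (hf : PolyTime f) (hg : PolyTime g) :
    PolyTime fun a => (f a, g a) := by
  have hg' := hg.polyBdd_size
  obtain ⟨c, k, hk, h⟩ := hf
  obtain ⟨c', k', hk', h'⟩ := hg
  exact ⟨.seq dup (.seq c' (.seq swap (.seq c (.push .main .bra)))), _,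
    (((PolyBdd.const 10).mul .size).add (.const 7)).add (hk'.add
      (((((PolyBdd.const 8).mul hg').add ((PolyBdd.const 8).mul .size)).add
        (.const 12)).add (hk.add (.const 1)))), fun a M A B C =>
    (exec_dup_word a M A B C).seq ((h' a _ A B C).seq ((exec_swap_word (g a) a M A B C).seq
      ((h a _ A B C).seq (exec_bra_word (f a) (g a) M A B C))))⟩

theorem fst : PolyTime fun p : α × β => p.1 := by
  refine ⟨pop .main fun _ => .seq swap drop, _,
    (((PolyBdd.const 14).mul .size).add (.const 18)), fun p M A B C => Exec.mono (Exec.pop ?_)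
      (n := 8 * size p.1 + 8 * size p.2 + 12 + (6 * size p.2 + 5) + 1) ?_⟩
  · rw [word_pair]
    simpa using (exec_swap_word p.1 p.2 M A B C).seq (exec_drop_word p.2 _ A B C)
  · rw [size_pair]; omega

theorem snd : PolyTime fun p : α × β => p.2 := by
  refine ⟨pop .main fun _ => drop, _,
    (((PolyBdd.const 6).mul .size).add (.const 6)), fun p M A B C => Exec.mono (Exec.pop ?_)
      (n := 6 * size p.1 + 5 + 1) ?_⟩
  · rw [word_pair]
    simpa using exec_drop_word p.1 (word p.2 ++ M) A B C
  · rw [size_pair]; omega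

theorem of_eq {f g : α → β} (hf : PolyTime f) (h : ∀ a, f a = g a) : PolyTime g := by
  obtain rfl : f = g := funext h
  exact hf

/-- A function that changes the code word by a fixed prefix only. -/
theorem of_word_eq {f : α → β} (h : ∀ a, word (f a) = word a) : PolyTime f :=
  ⟨.skip, _, .const 0, fun a M A B C => by rw [h]; exact Exec.skip _⟩

/-- A nonempty list has the same code word as the pair of its head and tail, so forming it is free.
-/
theorem cons {f : α → β} {g : α → List β} (hf : PolyTime f) (hg : PolyTime g) :
    PolyTime fun a => f a :: g a :=
  (of_word_eq (f := fun p : β × List β => p.1 :: p.2) fun _ => rfl).comp (hf.pair hg)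

theorem ite {c : α → Bool} {f g : α → β} (hc : PolyTime c) (hf : PolyTime f) (hg : PolyTime g) :
    PolyTime fun a => bif c a then f a else g a := by
  obtain ⟨d, k, hk, h⟩ := hc.pair id
  obtain ⟨d₁, k₁, hk₁, h₁⟩ := hf
  obtain ⟨d₂, k₂, hk₂, h₂⟩ := hg
  -- On the code of `(c a, a)` two pops remove the `bra` and the bit and leave exactly the code of
  -- `a`.
  refine ⟨.seq d (pop .main fun _ => pop .main fun o => match o with
    | some (.bit true) => d₁
    | _ => d₂), _, hk.add (((hk₁.add hk₂).add (.const 1)).add (.const 1)), fun a M A B C => ?_⟩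
  refine (h a M A B C).seq (Exec.pop (Exec.pop (Exec.mono
    (n := bif c a then k₁ a else k₂ a) ?_ ?_)))
  · rw [word_pair, word_bool]
    cases hc : c a
    · simpa [hc] using h₂ a M A B C
    · simpa [hc] using h₁ a M A B C
  · cases c a
    · exact Nat.le_add_left _ _
    · exact Nat.le_add_right _ _

theorem listCases {l : α → List γ} {f : α → β} {g : α → γ → List γ → β} (hl : PolyTime l)
    (hf : PolyTime f) (hg : PolyTime fun p : α × γ × List γ => g p.1 p.2.1 p.2.2) :
    PolyTime fun a => match l a with
      | [] => f a
      | x :: l' => g a x l' := by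
  obtain ⟨d, k, hk, h⟩ := hl.pair id
  obtain ⟨d₁, k₁, hk₁, h₁⟩ := hf
  obtain ⟨d₂, k₂, ⟨p, hp⟩, h₂⟩ := hg
  -- The first symbol of the list tells whether it is empty. A `bra` is put back, so that head and
  -- tail form a pair, which is then brought below `a` to form `(a, x, l')`.
  refine ⟨.seq d (pop .main fun _ => pop .main fun o => match o with
    | some .bra => .seq (.push .main .bra) (.seq swap (.seq (.push .main .bra) d₂))
    | _ => d₁), _, hk.add ((((((PolyBdd.const 8).mul
      (hl.polyBdd_size.add .size)).add (.const 14)).add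
      (((hl.polyBdd_size.add .size).add (.const 1)).eval p)).add hk₁).add (.const 2)), fun a M A B C => ?_⟩
  rcases hla : l a with _ | ⟨x, l'⟩
  · refine (h a M A B C).seq ((Exec.pop (Exec.pop (n := k₁ a) ?_)).mono (by omega))
    simp only [word_pair, hla]
    simpa [word_nil] using h₁ a M A B C
  · refine (h a M A B C).seq ((Exec.pop (Exec.pop
      (n := 1 + ((8 * size (x, l') + 8 * size a + 12) + (1 + k₂ (a, x, l')))) ?_)).mono ?_)
    · have h3 := (exec_bra_word x l' (word a ++ M) A B C).seq
        ((exec_swap_word (x, l') a M A B C).seq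
          ((exec_bra_word a (x, l') M A B C).seq (h₂ (a, x, l') M A B C)))
      simp only [word_pair, hla]
      simpa [word_cons] using h3
    · have h3 := hp (a, x, l')
      have h4 := eval_mono p (a := size (a, x, l')) (b := size (x :: l') + size a + 1) (by
        simp; omega)
      simp only [size_pair, size_cons] at h3 h4 ⊢
      omega

/-- The body of a fold: with the stack holding the head, the tail and the accumulator, run `c` on
the pair of the head and the accumulator. -/
def foldStep (c : Cmd) : Cmd :=
  .seq (take true false) (.seq swap (.seq (put .left) (.seq (.push .main .bra) (.seq c swap))))

theorem exec_foldStep {c : Cmd} {x : γ} {l : List γ} {b b' : β} {n : ℕ} {M A B C : List Γ'}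
    (h : Exec c (st (word (x, b) ++ (word l ++ M)) A B C) (st (word b' ++ (word l ++ M)) A B C) n) :
    Exec (foldStep c) (st (word x ++ (word l ++ (word b ++ M))) A B C)
      (st (word l ++ (word b' ++ M)) A B C)
      (8 * size x + 8 * size b + 8 * size b' + 16 * size l + n + 31) :=
  ((exec_take true false (tree x) _ A B C).seq ((exec_swap (tree l) (tree b) M _ _ _).seq
    ((exec_restore_left (tree x) _ _ _ _).seq ((exec_bra_word x b _ A B C).seq
      (h.seq (exec_swap_word b' l M A B C)))))).mono (by simp only [size, word]; omega)

/-- The loop of a fold. -/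
def foldLoop (c : Cmd) : Cmd :=
  .loop .main (fun o => o == some .bra) fun o => bif o == some .bra then foldStep c else .skip

/-- `L` bounds the list, `G` all accumulators met on the way and `T` one application of `c`, so
every round has the same bound; it follows from that of `exec_foldStep`, plus one for the pop of the
loop. -/
theorem exec_foldLoop {c : Cmd} {f : β → γ → β} {L G T : ℕ} (hf : ∀ x b M A B C,
      size x ≤ L → size b ≤ G → Exec c (st (word (x, b) ++ M) A B C) (st (word (f b x) ++ M) A B C) T)
    (l : List γ) : ∀ (b : β) (M A B C : List Γ'), size l ≤ L →
      (∀ l', l' <+: l → size (l'.foldl f b) ≤ G) →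
      Exec (foldLoop c) (st (word l ++ (word b ++ M)) A B C) (st (word (l.foldl f b) ++ M) A B C)
        (l.length * (24 * L + 16 * G + T + 32) + 1) := by
  induction l with
  | nil =>
    intro b M A B C _ _
    exact (Exec.exit (n := 0) (by simp [word_nil]) (by
      simpa [word_nil, show (Γ'.bit false == Γ'.bra) = false from rfl] using Exec.skip _)).mono
      (by simp)
  | cons x l ih =>
    intro b M A B C hL hG
    simp only [size_cons] at hL
    have h0 : size b ≤ G := hG [] (by simp)
    have h1 : size (f b x) ≤ G := hG [x] (by simp)
    have h2 := ih (f b x) M A B C (by omega) fun l' hl' => by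
      simpa using hG (x :: l') (by simpa using hl')
    refine (Exec.again (by simp [word_cons]) (Exec.mono (m := 24 * L + 16 * G + T + 31)
      (n := 8 * size x + 8 * size b + 8 * size (f b x) + 16 * size l + T + 31) ?_ ?_) h2).mono ?_
    · have h3 := exec_foldStep (hf x b (word l ++ M) A B C (by omega) h0)
      simpa [word_cons] using h3
    · omega
    · rw [List.length_cons, Nat.succ_mul l.length]; omega

theorem foldl_aux {l : α → List γ} {i : α → β} {f : β → γ → β} (hl : PolyTime l) (hi : PolyTime i)
    (hf : PolyTime fun p : γ × β => f p.2 p.1) {g : α → ℕ} (hg : PolyBdd g)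
    (hb : ∀ a l', l' <+: l a → size (l'.foldl f (i a)) ≤ g a) :
    PolyTime fun a => (l a).foldl f (i a) := by
  obtain ⟨d, k, hk, h⟩ := hl.pair hi
  obtain ⟨c, k', ⟨p, hp⟩, h'⟩ := hf
  refine ⟨.seq d (pop .main fun _ => foldLoop c), _, hk.add (((hl.polyBdd_size.mul
    (((((PolyBdd.const 24).mul hl.polyBdd_size).add ((PolyBdd.const 16).mul hg)).add
      (((hl.polyBdd_size.add hg).add (.const 1)).eval p)).add (.const 32))).add
      (.const 1)).add (.const 1)), fun a M A B C => (h a M A B C).seq (Exec.pop (Exec.mono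
      (n := (l a).length * (24 * size (l a) + 16 * g a + p.eval (size (l a) + g a + 1) + 32) + 1)
      ?_ ?_))⟩
  · have := exec_foldLoop (c := c) (f := f) (L := size (l a)) (G := g a)
      (T := p.eval (size (l a) + g a + 1)) (fun x b M A B C hx hb =>
        (h' (x, b) M A B C).mono ((hp _).trans (eval_mono p (by simp; omega)))) (l a) (i a) M A B C
        le_rfl (hb a)
    rw [word_pair]
    simpa using this
  · have := length_lt_size (l a)
    gcongr

/-- Folds with polynomially bounded accumulators. -/
theorem foldl {l : α → List γ} {i : α → β} {f : α → β → γ → β} (hl : PolyTime l) (hi : PolyTime i)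
    (hf : PolyTime fun p : α × β × γ => f p.1 p.2.1 p.2.2) {g : α → ℕ} (hg : PolyBdd g)
    (hb : ∀ a l', l' <+: l a → size (l'.foldl (f a) (i a)) ≤ g a) :
    PolyTime fun a => (l a).foldl (f a) (i a) := by
  -- In `foldl_aux` the step cannot depend on `a`; the parameter is therefore carried along in the
  -- accumulator.
  have key : ∀ (a : α) (l' : List γ) (b : β),
      l'.foldl (fun (q : α × β) x => (q.1, f q.1 q.2 x)) (a, b) = (a, l'.foldl (f a) b) := by
    intro a l'
    induction l' with
    | nil => simp
    | cons x l' ih => intro b; simp [ih]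
  have h := foldl_aux (i := fun a => (a, i a)) (f := fun (q : α × β) x => (q.1, f q.1 q.2 x))
    hl (id.pair hi) ((fst.comp snd).pair (hf.comp ((fst.comp snd).pair ((snd.comp snd).pair fst))))
    ((PolyBdd.size.add hg).add (.const 1)) (fun a l' hl' => by
      rw [key]; simpa using hb a l' hl')
  exact (snd.comp h).of_eq fun a => by rw [key]

end PolyTime

end StackProgram

/-! ### A library of polynomial time computable functions -/

namespace StackProgram

open Computability Turing TreeCode

/-- Binary digits make the size of a number proportional to its length, so that polynomial bounds
refer to the binary encoding. -/
instance : TreeCode ℕ := ⟨fun n => listTree n.bits⟩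

theorem word_bits (n : ℕ) : word n.bits = word n := rfl

theorem size_list_bool (l : List Bool) : size l = 2 * l.length + 1 := by
  induction l with
  | nil => rfl
  | cons b l ih => simp [ih]; omega

theorem size_nat (n : ℕ) : size n = 2 * n.size + 1 := by
  rw [← Nat.size_eq_bits_len, ← size_list_bool]; rfl

theorem size_nat_mono {m n : ℕ} (h : m ≤ n) : size m ≤ size n := by
  have := Nat.size_le_size h
  rw [size_nat, size_nat]; omega

theorem size_le_of_lt_two_pow {n k : ℕ} (h : n < 2 ^ k) : size n ≤ 2 * k + 1 := by
  have := Nat.size_le.2 h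
  rw [size_nat]; omega

theorem lt_two_pow_of_size_le {n k : ℕ} (h : size n ≤ 2 * k + 1) : n < 2 ^ k := by
  rw [size_nat] at h
  exact Nat.size_le.1 (by omega)

attribute [fun_prop] PolyTime PolyTime.id PolyTime.const PolyTime.comp PolyTime.pair PolyTime.fst PolyTime.snd PolyTime.cons
  PolyTime.ite

namespace PolyTime

variable {α β γ δ : Type} [TreeCode α] [TreeCode β] [TreeCode γ] [TreeCode δ]

@[fun_prop]
theorem fst' {f : α → β × γ} (hf : PolyTime f) : PolyTime fun a => (f a).1 := fst.comp hf

@[fun_prop]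
theorem snd' {f : α → β × γ} (hf : PolyTime f) : PolyTime fun a => (f a).2 := snd.comp hf

/-! #### Booleans -/

theorem bool₁ {f : α → Bool} (g : Bool → β) (hf : PolyTime f) : PolyTime fun a => g (f a) :=
  (hf.ite (const (g true)) (const (g false))).of_eq fun a => by cases f a <;> rfl

theorem bool₂ {f f' : α → Bool} (g : Bool → Bool → β) (hf : PolyTime f) (hf' : PolyTime f') :
    PolyTime fun a => g (f a) (f' a) :=
  (hf.ite (hf'.bool₁ (g true)) (hf'.bool₁ (g false))).of_eq fun a => by cases f a <;> rfl

theorem bool₃ {f f' f'' : α → Bool} (g : Bool → Bool → Bool → β) (hf : PolyTime f) (hf' : PolyTime f')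
    (hf'' : PolyTime f'') : PolyTime fun a => g (f a) (f' a) (f'' a) :=
  (hf.ite (bool₂ (g true) hf' hf'') (bool₂ (g false) hf' hf'')).of_eq fun a => by
    cases f a <;> rfl

@[fun_prop]
theorem and {f g : α → Bool} (hf : PolyTime f) (hg : PolyTime g) : PolyTime fun a => f a && g a :=
  bool₂ _ hf hg

@[fun_prop]
theorem or {f g : α → Bool} (hf : PolyTime f) (hg : PolyTime g) : PolyTime fun a => f a || g a :=
  bool₂ _ hf hg

@[fun_prop]
theorem not {f : α → Bool} (hf : PolyTime f) : PolyTime fun a => !f a :=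
  bool₁ _ hf

/-! #### Lists -/

/-- Folds whose steps add boundedly many symbols to the accumulator. -/
theorem foldl_of_add {l : α → List γ} {i : α → β} {f : α → β → γ → β} (hl : PolyTime l) (hi : PolyTime i)
    (hf : PolyTime fun p : α × β × γ => f p.1 p.2.1 p.2.2) {h : α → ℕ} (hh : PolyBdd h)
    (hb : ∀ a, ∀ x ∈ l a, ∀ b, size (f a b x) ≤ size b + h a) :
    PolyTime fun a => (l a).foldl (f a) (i a) := by
  refine foldl hl hi hf (hi.polyBdd_size.add (hl.polyBdd_size.mul hh)) fun a l' hl' => ?_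
  have key : ∀ l'' : List γ, (∀ x ∈ l'', x ∈ l a) → ∀ b,
      size (l''.foldl (f a) b) ≤ size b + l''.length * h a := by
    intro l''
    induction l'' with
    | nil => simp
    | cons x l'' ih =>
      intro hx b
      have h1 := ih (fun y hy => hx y (by simp [hy])) (f a b x)
      have h2 := hb a x (hx x (by simp)) b
      simp only [List.foldl_cons, List.length_cons, Nat.succ_mul]
      omega
  refine (key l' (fun x hx => hl'.subset hx) (i a)).trans (Nat.add_le_add_left
    (Nat.mul_le_mul_right _ ?_) _)
  exact hl'.length_le.trans (length_lt_size _).le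

@[fun_prop]
theorem reverse {l : α → List γ} (hl : PolyTime l) : PolyTime fun a => (l a).reverse := by
  refine (foldl_of_add (f := fun _ acc x => x :: acc) (h := fun a => size (l a) + 1) hl (const [])
    (by fun_prop) (hl.polyBdd_size.add (.const 1)) fun a x hx b => ?_).of_eq fun a => by simp
  have := size_le_of_mem hx
  simp; omega

theorem foldr_of_add {l : α → List γ} {i : α → β} {f : α → γ → β → β} (hl : PolyTime l) (hi : PolyTime i)
    (hf : PolyTime fun p : α × β × γ => f p.1 p.2.2 p.2.1) {h : α → ℕ} (hh : PolyBdd h)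
    (hb : ∀ a, ∀ x ∈ l a, ∀ b, size (f a x b) ≤ size b + h a) :
    PolyTime fun a => (l a).foldr (f a) (i a) :=
  (foldl_of_add (f := fun a b x => f a x b) hl.reverse hi hf hh fun a x hx b =>
    hb a x (by simpa using hx) b).of_eq fun a => by simp

theorem map {l : α → List γ} {f : α → γ → β} (hl : PolyTime l)
    (hf : PolyTime fun p : α × γ => f p.1 p.2) : PolyTime fun a => (l a).map (f a) := by
  obtain ⟨p, hp⟩ := hf.polyBdd_size
  refine (foldr_of_add (f := fun a x acc => f a x :: acc) (i := fun _ => []) hl (const [])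
    (cons (hf.comp (g := fun p : α × List β × γ => (p.1, p.2.2)) (by fun_prop)) (by fun_prop))
    ((((PolyBdd.size (α := α)).add hl.polyBdd_size).eval p).add (.const 1))
    fun a x hx b => ?_).of_eq fun a => by induction l a <;> simp_all
  have h1 := size_le_of_mem hx
  have h2 := (hp (a, x)).trans (eval_mono p (b := size a + size (l a)) (by simp; omega))
  simp only [size_cons] at h2 ⊢
  omega

theorem any {l : α → List γ} {f : α → γ → Bool} (hl : PolyTime l)
    (hf : PolyTime fun p : α × γ => f p.1 p.2) : PolyTime fun a => (l a).any (f a) := by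
  refine (foldr_of_add (f := fun a x acc => f a x || acc) (i := fun _ => false) hl (const false)
    (or (hf.comp (g := fun p : α × Bool × γ => (p.1, p.2.2)) (by fun_prop)) (by fun_prop))
    (PolyBdd.const 0) fun a x hx b => by simp).of_eq fun a => by induction l a <;> simp_all

/-! #### Natural numbers -/

@[fun_prop]
theorem bits {f : α → ℕ} (hf : PolyTime f) : PolyTime fun a => (f a).bits :=
  (of_word_eq word_bits).comp hf

theorem of_bits {f : α → ℕ} (hf : PolyTime fun a => (f a).bits) : PolyTime f := by
  obtain ⟨c, g, hg, h⟩ := hf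
  exact ⟨c, g, hg, h⟩

theorem isZero {f : α → ℕ} (hf : PolyTime f) : PolyTime fun a => f a == 0 :=
  (listCases hf.bits (const true) (g := fun _ _ _ => false) (const false)).of_eq fun a => by
    rcases h : (f a).bits with _ | ⟨x, l⟩
    · have h1 : (f a).size = 0 := by rw [← Nat.size_eq_bits_len, h]; rfl
      simp [Nat.size_eq_zero.1 h1]
    · have h1 : f a ≠ 0 := by rintro h0; simp [h0] at h
      simp [h1]

@[fun_prop]
theorem bit {b : α → Bool} {f : α → ℕ} (hb : PolyTime b) (hf : PolyTime f) :
    PolyTime fun a => Nat.bit (b a) (f a) :=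
  -- The digit list of zero is empty, so a digit `false` must not be put in front of it.
  of_bits ((((hb.not).and hf.isZero).ite (const []) (hb.cons hf.bits)).of_eq fun a => by
    by_cases h : b a = false ∧ f a = 0
    · simp [h.1, h.2]
    · rw [Nat.bits_append_bit _ _ (fun h0 => by by_contra h1; simp_all)]
      have h1 : (f a == 0) = true → b a = true := fun h1 => by
        by_contra h2
        exact h ⟨by simpa using h2, by simpa using h1⟩
      cases hb : b a <;> cases hf : f a == 0 <;> simp_all)

@[fun_prop]
theorem bodd {f : α → ℕ} (hf : PolyTime f) : PolyTime fun a => (f a).bodd :=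
  (listCases hf.bits (const false) (g := fun _ x _ => x) (by fun_prop)).of_eq fun a => by
    rw [Nat.bodd_eq_bits_head]
    cases (f a).bits <;> rfl

@[fun_prop]
theorem div2 {f : α → ℕ} (hf : PolyTime f) : PolyTime fun a => (f a).div2 :=
  of_bits ((listCases hf.bits (const []) (g := fun _ _ l => l) (by fun_prop)).of_eq fun a => by
    rw [Nat.div2_bits_eq_tail]
    cases (f a).bits <;> rfl)

end PolyTime

/-! ### Binary addition -/

/-- One step of the addition of two binary numbers: the state consists of the carry, the remaining
digits, and the digits of the sum, the most significant one first. -/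
def addStep (s : (Bool × ℕ × ℕ) × List Bool) : (Bool × ℕ × ℕ) × List Bool :=
  ((bif s.1.1 then s.1.2.1.bodd || s.1.2.2.bodd else s.1.2.1.bodd && s.1.2.2.bodd,
    s.1.2.1.div2, s.1.2.2.div2), (s.1.1 ^^ (s.1.2.1.bodd ^^ s.1.2.2.bodd)) :: s.2)

/-- The number with the given binary digits, the most significant one first, after those of `n`. -/
def ofDigits (n : ℕ) (l : List Bool) : ℕ :=
  l.foldl (fun n b => Nat.bit b n) n

/-- A full adder: the last digit is the parity of the three bits, the new carry their majority. -/
theorem add_eq_bit (c : Bool) (m n : ℕ) : c.toNat + m + n =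
    Nat.bit (c ^^ (m.bodd ^^ n.bodd)) ((bif c then m.bodd || n.bodd else m.bodd && n.bodd).toNat +
      m.div2 + n.div2) := by
  have hm := Nat.bodd_add_div2 m
  have hn := Nat.bodd_add_div2 n
  rw [Nat.bit_val]
  cases c <;> cases h1 : m.bodd <;> cases h2 : n.bodd <;> simp_all <;> omega

theorem ofDigits_addStep (s : (Bool × ℕ × ℕ) × List Bool) :
    ofDigits ((addStep s).1.1.toNat + (addStep s).1.2.1 + (addStep s).1.2.2) (addStep s).2 =
      ofDigits (s.1.1.toNat + s.1.2.1 + s.1.2.2) s.2 := by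
  conv_rhs => rw [add_eq_bit]
  rfl

/-- Loop invariant: the digits found so far, appended to carry plus remaining operands, always
represent the same number. The entries of `l` play no role, only the number of rounds does. -/
theorem foldl_addStep (l : List Bool) : ∀ s : (Bool × ℕ × ℕ) × List Bool,
    ofDigits ((l.foldl (fun s _ => addStep s) s).1.1.toNat +
      (l.foldl (fun s _ => addStep s) s).1.2.1 + (l.foldl (fun s _ => addStep s) s).1.2.2)
      (l.foldl (fun s _ => addStep s) s).2 = ofDigits (s.1.1.toNat + s.1.2.1 + s.1.2.2) s.2 ∧
    (l.foldl (fun s _ => addStep s) s).1.2.1 = s.1.2.1 / 2 ^ l.length ∧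
    (l.foldl (fun s _ => addStep s) s).1.2.2 = s.1.2.2 / 2 ^ l.length ∧
    (l.foldl (fun s _ => addStep s) s).2.length = s.2.length + l.length := by
  induction l with
  | nil => simp
  | cons x l ih =>
    intro s
    obtain ⟨h1, h2, h3, h4⟩ := ih (addStep s)
    simp only [List.foldl_cons, List.length_cons]
    refine ⟨h1.trans (ofDigits_addStep s), ?_, ?_, ?_⟩
    · rw [h2, addStep, Nat.div2_val, Nat.div_div_eq_div_mul, pow_succ']
    · rw [h3, addStep, Nat.div2_val s.1.2.2, Nat.div_div_eq_div_mul, pow_succ']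
    · rw [h4]; simp [addStep]; omega

theorem bits_length_div {m n : ℕ} (h : m.bits.length ≤ n) : m / 2 ^ n = 0 := by
  rw [Nat.size_eq_bits_len, Nat.size_le] at h
  exact Nat.div_eq_of_lt h

namespace PolyTime

variable {α β γ δ : Type} [TreeCode α] [TreeCode β] [TreeCode γ] [TreeCode δ]

@[fun_prop]
theorem append {l l' : α → List γ} (hl : PolyTime l) (hl' : PolyTime l') : PolyTime fun a => l a ++ l' a := by
  refine (foldr_of_add (f := fun _ x acc => x :: acc) (h := fun a => size (l a) + 1) hl hl'
    (by fun_prop) (hl.polyBdd_size.add (.const 1)) fun a x hx b => ?_).of_eq fun a => by simp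
  have := size_le_of_mem hx
  simp; omega

theorem ofDigits {f : α → ℕ} {l : α → List Bool} (hf : PolyTime f) (hl : PolyTime l) :
    PolyTime fun a => StackProgram.ofDigits (f a) (l a) := by
  refine foldl_of_add (f := fun _ n b => Nat.bit b n) hl hf (by fun_prop) (.const 2)
    fun a x _ n => ?_
  rw [size_nat n]
  refine size_le_of_lt_two_pow (k := n.size + 1) ?_
  have := n.lt_size_self
  rw [Nat.bit_val, pow_succ]
  cases x <;> simp <;> omega

@[fun_prop]
theorem add {f g : α → ℕ} (hf : PolyTime f) (hg : PolyTime g) : PolyTime fun a => f a + g a := by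
  -- The concatenated digit lists merely supply enough rounds to exhaust both operands.
  have h1 : PolyTime fun a => ((f a).bits ++ (g a).bits).foldl (fun s _ => addStep s)
      ((false, f a, g a), []) := by
    refine foldl (f := fun _ s _ => addStep s) (by fun_prop) (by fun_prop)
      (g := fun a => 3 * (size (f a) + size (g a)) + 5) ?_ ?_ ?_
    · unfold addStep
      refine pair (pair ?_ ?_) (cons (bool₃ (fun a b c => a ^^ (b ^^ c)) ?_ ?_ ?_) ?_) <;> fun_prop
    · exact ((PolyBdd.const 3).mul (hf.polyBdd_size.add hg.polyBdd_size)).add (.const 5)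
    · intro a l' hl'
      obtain ⟨-, h2, h3, h4⟩ := foldl_addStep l' ((false, f a, g a), [])
      have h5 := size_nat_mono (Nat.div_le_self (f a) (2 ^ l'.length))
      have h6 := size_nat_mono (Nat.div_le_self (g a) (2 ^ l'.length))
      have h7 := hl'.length_le
      rw [List.length_append, Nat.size_eq_bits_len, Nat.size_eq_bits_len] at h7
      have h8 := size_nat (f a)
      have h9 := size_nat (g a)
      simp only [size_pair, size_bool, size_list_bool, h2, h3, h4, List.length_nil]
      omega
  -- The last carry is what remains when both operands are used up; it becomes the leading part.
  refine (ofDigits (f := fun a => Nat.bit (((f a).bits ++ (g a).bits).foldl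
    (fun s _ => addStep s) ((false, f a, g a), [])).1.1 0) (by fun_prop) (snd.comp h1)).of_eq
    fun a => ?_
  obtain ⟨h2, h3, h4, -⟩ := foldl_addStep ((f a).bits ++ (g a).bits) ((false, f a, g a), [])
  rw [h3, h4, bits_length_div (by simp), bits_length_div (by simp)] at h2
  simpa [Nat.bit_val, StackProgram.ofDigits] using h2

end PolyTime

/-! ### Comparison and multiplication -/

/-- One step of the comparison of two binary numbers. -/
def leStep (s : Bool × ℕ × ℕ) : Bool × ℕ × ℕ :=
  (bif s.2.1.bodd ^^ s.2.2.bodd then s.2.2.bodd else s.1, s.2.1.div2, s.2.2.div2)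

/-- The flag compares the digits already removed. These are the less significant ones, so it matters
only if the remaining parts are equal; with both exhausted it is the answer. -/
theorem leStep_iff (s : Bool × ℕ × ℕ) :
    ((leStep s).2.1 < (leStep s).2.2 ∨ (leStep s).2.1 = (leStep s).2.2 ∧ (leStep s).1) ↔
      (s.2.1 < s.2.2 ∨ s.2.1 = s.2.2 ∧ s.1) := by
  have hm := Nat.bodd_add_div2 s.2.1
  have hn := Nat.bodd_add_div2 s.2.2
  unfold leStep
  revert hm hn
  cases s.2.1.bodd <;> cases s.2.2.bodd <;> cases s.1 <;> simp <;> omega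

theorem foldl_leStep (l : List Bool) : ∀ s : Bool × ℕ × ℕ,
    (((l.foldl (fun s _ => leStep s) s).2.1 < (l.foldl (fun s _ => leStep s) s).2.2 ∨
      (l.foldl (fun s _ => leStep s) s).2.1 = (l.foldl (fun s _ => leStep s) s).2.2 ∧
        (l.foldl (fun s _ => leStep s) s).1) ↔ (s.2.1 < s.2.2 ∨ s.2.1 = s.2.2 ∧ s.1)) ∧
    (l.foldl (fun s _ => leStep s) s).2.1 = s.2.1 / 2 ^ l.length ∧
    (l.foldl (fun s _ => leStep s) s).2.2 = s.2.2 / 2 ^ l.length := by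
  induction l with
  | nil => simp
  | cons x l ih =>
    intro s
    obtain ⟨h1, h2, h3⟩ := ih (leStep s)
    simp only [List.foldl_cons, List.length_cons]
    refine ⟨h1.trans (leStep_iff s), ?_, ?_⟩
    · rw [h2, leStep, Nat.div2_val, Nat.div_div_eq_div_mul, pow_succ']
    · rw [h3, leStep, Nat.div2_val s.2.2, Nat.div_div_eq_div_mul, pow_succ']

theorem foldr_bits (n : ℕ) : n.bits.foldr (fun b n => Nat.bit b n) 0 = n := by
  induction n using Nat.binaryRec' with
  | zero => simp
  | bit b n h ih => rw [Nat.bits_append_bit n b h, List.foldr_cons, ih]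

namespace PolyTime

variable {α β γ δ : Type} [TreeCode α] [TreeCode β] [TreeCode γ] [TreeCode δ]

@[fun_prop]
theorem le {f g : α → ℕ} (hf : PolyTime f) (hg : PolyTime g) : PolyTime fun a => decide (f a ≤ g a) := by
  have h1 : PolyTime fun a => ((f a).bits ++ (g a).bits).foldl (fun s _ => leStep s)
      (true, f a, g a) := by
    refine foldl (f := fun _ s _ => leStep s) (by fun_prop) (by fun_prop)
      (g := fun a => size (f a) + size (g a) + 3) ?_ ?_ ?_
    · unfold leStep
      refine pair (ite (bool₂ (fun a b => a ^^ b) ?_ ?_) ?_ ?_) ?_ <;> fun_prop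
    · exact (hf.polyBdd_size.add hg.polyBdd_size).add (.const 3)
    · intro a l' hl'
      obtain ⟨-, h2, h3⟩ := foldl_leStep l' (true, f a, g a)
      have h5 := size_nat_mono (Nat.div_le_self (f a) (2 ^ l'.length))
      have h6 := size_nat_mono (Nat.div_le_self (g a) (2 ^ l'.length))
      simp only [size_pair, size_bool, h2, h3]
      omega
  refine (fst.comp h1).of_eq fun a => ?_
  obtain ⟨h2, h3, h4⟩ := foldl_leStep ((f a).bits ++ (g a).bits) (true, f a, g a)
  rw [h3, h4, bits_length_div (by simp), bits_length_div (by simp)] at h2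
  rw [Bool.eq_iff_iff, decide_eq_true_eq, le_iff_lt_or_eq]
  simpa using h2

@[fun_prop]
theorem beq {f g : α → ℕ} (hf : PolyTime f) (hg : PolyTime g) : PolyTime fun a => f a == g a :=
  ((hf.le hg).and (hg.le hf)).of_eq fun a => by
    rw [Bool.eq_iff_iff, Bool.and_eq_true, decide_eq_true_eq, decide_eq_true_eq, beq_iff_eq]
    omega

@[fun_prop]
theorem min {f g : α → ℕ} (hf : PolyTime f) (hg : PolyTime g) : PolyTime fun a => min (f a) (g a) :=
  ((hf.le hg).ite hf hg).of_eq fun a => by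
    by_cases h : f a ≤ g a
    · simp [h]
    · simp [h, le_of_not_ge h]

@[fun_prop]
theorem mul {f g : α → ℕ} (hf : PolyTime f) (hg : PolyTime g) : PolyTime fun a => f a * g a := by
  -- Shift and add: Horner's scheme over the digits of `f a`.
  have h1 : PolyTime fun a => (f a).bits.foldr
      (fun b n => Nat.bit false n + bif b then g a else 0) 0 := by
    refine foldr_of_add (f := fun a b n => Nat.bit false n + bif b then g a else 0) hf.bits
      (const 0) ?_ (h := fun a => size (g a) + 1) (hg.polyBdd_size.add (.const 1))
      fun a x _ n => ?_
    · exact add (by fun_prop) (ite (by fun_prop) (hg.comp fst) (by fun_prop))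
    · have h2 := n.lt_size_self
      have h3 := (g a).lt_size_self
      rw [size_nat n, size_nat (g a)]
      refine (size_le_of_lt_two_pow (k := n.size + (g a).size + 1) ?_).trans (by omega)
      have h4 : 2 ^ n.size ≤ 2 ^ (n.size + (g a).size) := Nat.pow_le_pow_right (by simp) (by simp)
      rw [pow_succ, Nat.bit_val]
      have h5 : n + 1 + g a ≤ 2 ^ (n.size + (g a).size) := by
        rw [pow_add]
        nlinarith
      cases x <;> simp <;> omega
  refine h1.of_eq fun a => ?_
  conv_rhs => rw [← foldr_bits (f a)]
  induction (f a).bits with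
  | nil => simp
  | cons b l ih =>
    rw [List.foldr_cons, List.foldr_cons, ih, Nat.bit_val, Nat.bit_val]
    cases b <;> simp <;> ring

theorem sum {l : α → List ℕ} (hl : PolyTime l) : PolyTime fun a => (l a).sum := by
  refine (foldr_of_add (f := fun _ x n => x + n) (i := fun _ => 0) hl (const 0) (by fun_prop)
    (h := fun a => size (l a)) hl.polyBdd_size fun a x hx n => ?_).of_eq fun a => rfl
  have h1 := size_le_of_mem hx
  have h2 := n.lt_size_self
  have h3 := x.lt_size_self
  rw [size_nat x] at h1
  rw [size_nat n]
  refine (size_le_of_lt_two_pow (k := n.size + x.size) ?_).trans (by omega)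
  rw [pow_add]
  nlinarith

end PolyTime

end StackProgram

/-! ### The algorithm for tree networks -/

namespace StackProgram

open Computability Turing TreeCode

/-- A symbol as a triple of bits. -/
def symbolCode : Γ' → Bool × Bool × Bool
  | .blank => (true, false, true)
  | .bit b => (false, b, false)
  | .bra => (true, true, false)
  | .ket => (true, true, true)
  | .comma => (true, false, false)

/-- The symbol with a given code. -/
def symbolDecode : Bool → Bool → Bool → Γ'
  | false, b, _ => .bit b
  | true, true, false => .bra
  | true, true, true => .ket
  | true, false, false => .comma
  | true, false, true => .blank

theorem symbolDecode_symbolCode (s : Γ') :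
    symbolDecode (symbolCode s).1 (symbolCode s).2.1 (symbolCode s).2.2 = s := by
  cases s <;> rfl

instance : TreeCode Γ' := ⟨fun s => tree (symbolCode s)⟩

namespace PolyTime

variable {α β γ δ : Type} [TreeCode α] [TreeCode β] [TreeCode γ] [TreeCode δ]

theorem symbol {f : α → Γ'} (g : Γ' → β) (hf : PolyTime f) : PolyTime fun a => g (f a) := by
  have h : PolyTime fun a => symbolCode (f a) := (of_word_eq (f := symbolCode) fun _ => rfl).comp hf
  exact (bool₃ (fun x y z => g (symbolDecode x y z)) h.fst' h.snd'.fst' h.snd'.snd').of_eq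
    fun a => by rw [symbolDecode_symbolCode]

@[fun_prop]
theorem tail {l : α → List γ} (hl : PolyTime l) : PolyTime fun a => (l a).tail :=
  (listCases hl (const []) (g := fun _ _ l => l) (by fun_prop)).of_eq fun a => by
    cases l a <;> rfl

@[fun_prop]
theorem getD {l : α → List ℕ} (i : ℕ) (hl : PolyTime l) : PolyTime fun a => (l a).getD i 0 := by
  induction i generalizing l with
  | zero =>
    exact (listCases hl (const 0) (g := fun _ x _ => x) (by fun_prop)).of_eq fun a => by
      cases l a <;> rfl
  | succ i ih =>
    exact (ih hl.tail).of_eq fun a => by cases l a <;> simp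

end PolyTime

end StackProgram

namespace TreeFlow

open Computability StackProgram

/-! #### Reading the input -/

/-- The state of the parser: the current group of numbers, the threshold, the lines and the nodes
read so far, and two flags telling whether the lines and the nodes have been reached. -/
abbrev ParserState : Type :=
  List ℕ × List ℕ × List (List ℕ) × List (List ℕ) × Bool × Bool

/-- Read a symbol; the input is read backwards. -/
def parseStep (s : Γ') (x : ParserState) : ParserState :=
  match s, x with
  | .bit _, ([], x) => ([], x)
  | .bit b, (n :: l, x) => (Nat.bit b n :: l, x)
  -- Read backwards, the first `ket` closes the list of lines, and the numbers collected before it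
  -- form the threshold.
  | .ket, (cur, _, ls, vs, false, _) => ([0], cur, ls, vs, true, false)
  | .ket, (_, t, ls, vs, true, _) => ([0], t, ls, vs, true, true)
  -- A new group starts with `[0]` because the two kind bits of a node are not closed by a comma;
  -- for a line this leaves a superfluous last entry `0`.
  | .bra, (cur, t, ls, vs, p, false) => ([0], t, cur :: ls, vs, p, false)
  | .bra, (cur, t, ls, vs, p, true) => ([0], t, ls, cur :: vs, p, true)
  | _, (cur, x) => (0 :: cur, x)

/-- Read a word. -/
def parse (w : List Γ') : ParserState :=
  w.foldr parseStep ([], [], [], [], false, false)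

theorem poly_parse : PolyTime parse := by
  refine PolyTime.foldr_of_add (f := fun _ s x => parseStep s x) PolyTime.id (PolyTime.const _) ?_
    (PolyBdd.const 8) fun _ s _ x => ?_
  · have hb : PolyTime fun p : List Γ' × ParserState × Γ' => symbolBit (some p.2.2) :=
      PolyTime.symbol (fun s => symbolBit (some s)) (by fun_prop)
    have hl := PolyTime.listCases (α := List Γ' × ParserState × Γ') (β := List ℕ)
      (l := fun p => p.2.1.1) (f := fun _ => []) (g := fun p n l =>
        Nat.bit (symbolBit (some p.2.2)) n :: l)
      (by fun_prop) (by fun_prop) (by have := hb.comp (PolyTime.fst (β := ℕ × List ℕ)); fun_prop)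
    -- `symbolBit` is `false` on symbols that are no bits, so this test recognises precisely the
    -- bits.
    refine ((PolyTime.symbol (fun s => symbolCode s == symbolCode (.bit (symbolBit (some s))))
      (f := fun p : List Γ' × ParserState × Γ' => p.2.2) (by fun_prop)).ite (hl.pair
        (g := fun p => p.2.1.2) (by fun_prop))
      ((PolyTime.symbol (fun s => symbolCode s == symbolCode .ket)
      (f := fun p : List Γ' × ParserState × Γ' => p.2.2) (by fun_prop)).ite
      (f := fun p => ([0], bif p.2.1.2.2.2.2.1 then p.2.1.2.1 else p.2.1.1, p.2.1.2.2.1,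
        p.2.1.2.2.2.1, true, p.2.1.2.2.2.2.1)) (by fun_prop)
      ((PolyTime.symbol (fun s => symbolCode s == symbolCode .bra)
      (f := fun p : List Γ' × ParserState × Γ' => p.2.2) (by fun_prop)).ite
      (f := fun p => ([0], p.2.1.2.1, bif p.2.1.2.2.2.2.2 then p.2.1.2.2.1 else
        p.2.1.1 :: p.2.1.2.2.1, bif p.2.1.2.2.2.2.2 then p.2.1.1 :: p.2.1.2.2.2.1 else
        p.2.1.2.2.2.1, p.2.1.2.2.2.2.1, p.2.1.2.2.2.2.2)) (by fun_prop)
      (g := fun p => (0 :: p.2.1.1, p.2.1.2)) (by fun_prop)))).of_eq ?_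
    rintro ⟨w, ⟨cur, t, ls, vs, p, q⟩, s⟩
    rcases s with _ | (_ | _) | _ | _ | _ <;> cases cur <;> cases p <;> cases q <;> rfl
  · obtain ⟨cur, t, ls, vs, p, q⟩ := x
    have hn : ∀ b n, size (Nat.bit b n) ≤ size n + 2 := by
      intro b n
      rw [size_nat n]
      refine size_le_of_lt_two_pow (k := n.size + 1) ?_
      have := n.lt_size_self
      rw [Nat.bit_val, pow_succ]
      cases b <;> simp <;> omega
    have h0 : size 0 = 1 := rfl
    rcases s with _ | b | _ | _ | _ <;> cases cur <;> cases p <;> cases q <;>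
      simp [parseStep, h0] <;> try omega
    all_goals have := hn b ‹_›; omega

/-! #### The maximum flow of a tree -/

/-- The product of the denominators of the capacities of the lines that differ from `e`. -/
def otherDens (L : List (List ℕ)) (e : List ℕ) : ℕ :=
  L.foldr (fun e' n => bif e'.getD 0 0 == e.getD 0 0 && e'.getD 1 0 == e.getD 1 0 then n else
    e'.getD 7 0 * n) 1

/-- The product of the denominators of the capacities. -/
def dens (L : List (List ℕ)) : ℕ :=
  L.foldr (fun e n => e.getD 7 0 * n) 1

/-- The lines with their capacities scaled to integers; lines whose susceptance vanishes get
capacity zero. -/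
def edges (L : List (List ℕ)) : List (ℕ × ℕ × ℕ) :=
  L.map fun e => (e.getD 0 0, e.getD 1 0,
    -- Entry 4 is the numerator of the upper susceptance limit and entry 6 that of the capacity.
    -- Multiplying by the other denominators scales the capacity by `dens` without a division.
    bif e.getD 4 0 == 0 then 0 else e.getD 6 0 * otherDens L e)

/-- Has `u` been reached from the node `0`? -/
def reached (O : List (ℕ × ℕ × ℕ)) (u : ℕ) : Bool :=
  u == 0 || O.any fun x => x.1 == u

/-- Add a line to the list if exactly one end has been reached, the new end in front. -/
def grow (O : List (ℕ × ℕ × ℕ)) (e : ℕ × ℕ × ℕ) : List (ℕ × ℕ × ℕ) :=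
  bif reached O e.1 && !reached O e.2.1 then (e.2.1, e.1, e.2.2) :: O else
    bif reached O e.2.1 && !reached O e.1 then e :: O else O

/-- The lines ordered such that every line leads from a new node to a later one. -/
def order {ι : Type} (V : List ι) (E : List (ℕ × ℕ × ℕ)) : List (ℕ × ℕ × ℕ) :=
  -- One sweep over all lines per node; each sweep extends the reached region by at least one layer
  -- of neighbours.
  V.foldl (fun O _ => E.foldl grow O) []

/-- The initial costs of a node being on the source side and on the sink side. -/
def initCosts (V : List (List ℕ)) (M : ℕ) : List (ℕ × ℕ × ℕ) :=
  -- Kind 2 is a load, kind 1 a generator. The total capacity `M` plays the role of infinity.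
  V.map fun v => (v.getD 0 0, bif v.getD 1 0 == 2 then M else 0, bif v.getD 1 0 == 1 then M else 0)

/-- The costs stored for a node. -/
def lookup (W : List (ℕ × ℕ × ℕ)) (v : ℕ) : ℕ × ℕ :=
  W.foldr (fun x y => bif x.1 == v then x.2 else y) (0, 0)

/-- Contract a leaf to its neighbour. -/
def contract (W : List (ℕ × ℕ × ℕ)) (e : ℕ × ℕ × ℕ) : List (ℕ × ℕ × ℕ) :=
  W.map fun x => bif x.1 == e.2.1 then
    (x.1, x.2.1 + min (lookup W e.1).1 ((lookup W e.1).2 + e.2.2),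
      x.2.2 + min (lookup W e.1).2 ((lookup W e.1).1 + e.2.2)) else x

/-- The value of a minimum cut. -/
def cutValue (V L : List (List ℕ)) : ℕ :=
  min
    (lookup ((order V (edges L)).foldl contract
      (initCosts V ((edges L).map fun e => e.2.2).sum)) 0).1
    (lookup ((order V (edges L)).foldl contract
      (initCosts V ((edges L).map fun e => e.2.2).sum)) 0).2

/-- Decide whether the maximum flow reaches the threshold. -/
def decideFlow (w : List Γ') : Bool :=
  -- The comparison of the threshold with `cutValue / dens`, cleared of denominators.
  decide ((parse w).2.1.getD 0 0 * dens (parse w).2.2.1 ≤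
    (parse w).2.1.getD 1 0 * cutValue (parse w).2.2.2.1 (parse w).2.2.1)

/-! ### Running time of the algorithm -/

section

variable {α : Type} [TreeCode α]

theorem size_mul_le (m n : ℕ) : size (m * n) ≤ size m + size n := by
  have hm := m.lt_size_self
  have hn := n.lt_size_self
  rw [size_nat m, size_nat n]
  refine (size_le_of_lt_two_pow (k := m.size + n.size) ?_).trans (by omega)
  rw [pow_add]
  exact Nat.mul_lt_mul'' hm hn

theorem size_getD_le (l : List ℕ) (i : ℕ) : size (l.getD i 0) ≤ size l := by
  by_cases h : i < l.length
  · rw [List.getD_eq_getElem _ _ h]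
    exact (size_le_of_mem (List.getElem_mem h)).le
  · rw [List.getD_eq_default _ _ (by omega)]
    have := length_lt_size l
    change 1 ≤ _
    omega

theorem poly_otherDens {L : α → List (List ℕ)} {e : α → List ℕ} (hL : PolyTime L) (he : PolyTime e) :
    PolyTime fun a => otherDens (L a) (e a) := by
  refine PolyTime.foldr_of_add (f := fun a e' n => bif e'.getD 0 0 == (e a).getD 0 0 &&
    e'.getD 1 0 == (e a).getD 1 0 then n else e'.getD 7 0 * n) hL (PolyTime.const 1) (by fun_prop)
    hL.polyBdd_size fun a x hx n => ?_
  have h1 := size_mul_le (x.getD 7 0) n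
  have h2 := size_getD_le x 7
  have h3 := size_le_of_mem hx
  cases x.getD 0 0 == (e a).getD 0 0 && x.getD 1 0 == (e a).getD 1 0 <;>
    simp only [cond_true, cond_false] <;> omega

theorem poly_dens {L : α → List (List ℕ)} (hL : PolyTime L) : PolyTime fun a => dens (L a) := by
  refine PolyTime.foldr_of_add (f := fun a e' n => e'.getD 7 0 * n) hL (PolyTime.const 1) (by fun_prop)
    hL.polyBdd_size fun a x hx n => ?_
  have h1 := size_mul_le (x.getD 7 0) n
  have h2 := size_getD_le x 7
  have h3 := size_le_of_mem hx
  omega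

@[fun_prop]
theorem poly_edges {L : α → List (List ℕ)} (hL : PolyTime L) : PolyTime fun a => edges (L a) := by
  refine PolyTime.map (f := fun a (e : List ℕ) => (e.getD 0 0, e.getD 1 0,
    bif e.getD 4 0 == 0 then 0 else e.getD 6 0 * otherDens (L a) e)) hL ?_
  have := poly_otherDens (hL.comp (PolyTime.fst (β := List ℕ))) PolyTime.snd
  fun_prop

@[fun_prop]
theorem poly_reached {O : α → List (ℕ × ℕ × ℕ)} {u : α → ℕ} (hO : PolyTime O) (hu : PolyTime u) :
    PolyTime fun a => reached (O a) (u a) := by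
  have := PolyTime.any (f := fun a (x : ℕ × ℕ × ℕ) => x.1 == u a) hO (by fun_prop)
  unfold reached
  fun_prop

theorem size_foldl_le {β γ : Type} [TreeCode β] {f : β → γ → β} {k : ℕ} {l : List γ}
    (h : ∀ x ∈ l, ∀ b, size (f b x) ≤ size b + k) (b : β) :
    size (l.foldl f b) ≤ size b + l.length * k := by
  induction l generalizing b with
  | nil => simp
  | cons x l ih =>
    have h1 := ih (fun y hy => h y (by simp [hy])) (f b x)
    have h2 := h x (by simp) b
    simp only [List.foldl_cons, List.length_cons, Nat.succ_mul]
    omega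

theorem size_grow_le (O : List (ℕ × ℕ × ℕ)) (e : ℕ × ℕ × ℕ) :
    size (grow O e) ≤ size O + (size e + 1) := by
  unfold grow
  cases reached O e.1 <;> cases reached O e.2.1 <;> simp <;> omega

@[fun_prop]
theorem poly_order {V : α → List (List ℕ)} {E : α → List (ℕ × ℕ × ℕ)} (hV : PolyTime V)
    (hE : PolyTime E) : PolyTime fun a => order (V a) (E a) := by
  have hb : ∀ a, ∀ x ∈ E a, ∀ O, size (grow O x) ≤ size O + size (E a) := fun a x hx O => by
    have h1 := size_le_of_mem hx
    have h2 := size_grow_le O x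
    omega
  refine PolyTime.foldl_of_add (f := fun a O _ => (E a).foldl grow O) hV (PolyTime.const []) ?_
    (h := fun a => size (E a) * size (E a)) (hE.polyBdd_size.mul hE.polyBdd_size)
    fun a x _ O => ?_
  · refine PolyTime.foldl_of_add (α := α × List (ℕ × ℕ × ℕ) × List ℕ) (f := fun _ O e => grow O e)
      (l := fun p => E p.1) (i := fun p => p.2.1) (by fun_prop) (by fun_prop) ?_
      ((hE.polyBdd_size).comp PolyTime.fst.polyBdd_size) fun p x hx O => hb p.1 x hx O
    unfold grow
    fun_prop
  · refine (size_foldl_le (hb a) O).trans (Nat.add_le_add_left (Nat.mul_le_mul_right _ ?_) _)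
    exact (length_lt_size _).le

@[fun_prop]
theorem poly_initCosts {V : α → List (List ℕ)} {M : α → ℕ} (hV : PolyTime V) (hM : PolyTime M) :
    PolyTime fun a => initCosts (V a) (M a) :=
  PolyTime.map (f := fun a (v : List ℕ) => (v.getD 0 0, bif v.getD 1 0 == 2 then M a else 0,
    bif v.getD 1 0 == 1 then M a else 0)) hV (by fun_prop)

theorem lookup_cons (x : ℕ × ℕ × ℕ) (W : List (ℕ × ℕ × ℕ)) (v : ℕ) :
    lookup (x :: W) v = bif x.1 == v then x.2 else lookup W v := rfl

theorem lookup_mem (W : List (ℕ × ℕ × ℕ)) (v : ℕ) :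
    lookup W v = (0, 0) ∨ ∃ x ∈ W, lookup W v = x.2 := by
  induction W with
  | nil => exact Or.inl rfl
  | cons x W ih =>
    rw [lookup_cons]
    cases h : x.1 == v
    · rcases ih with ih | ⟨y, hy, ih⟩
      · exact Or.inl ih
      · exact Or.inr ⟨y, by simp [hy], ih⟩
    · exact Or.inr ⟨x, by simp, rfl⟩

@[fun_prop]
theorem poly_lookup {W : α → List (ℕ × ℕ × ℕ)} {v : α → ℕ} (hW : PolyTime W) (hv : PolyTime v) :
    PolyTime fun a => lookup (W a) (v a) := by
  refine PolyTime.foldl (l := fun a => (W a).reverse) (i := fun _ => (0, 0))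
    (f := fun a y x => bif x.1 == v a then x.2 else y) (by fun_prop) (by fun_prop) (by fun_prop)
    (g := fun a => size (W a) + 3) (hW.polyBdd_size.add (.const 3)) (fun a l hl => ?_) |>.of_eq
    fun a => by simp [lookup]
  have h : l.foldl (fun y x => bif x.1 == v a then x.2 else y) (0, 0) = lookup l.reverse (v a) := by
    simp [lookup]
  rw [h]
  rcases lookup_mem l.reverse (v a) with h | ⟨x, hx, h⟩
  · rw [h]; simp; change 1 + 1 ≤ _; omega
  · rw [h]
    have := size_le_of_mem (l := W a) (a := x) (by simpa using hl.subset (by simpa using hx))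
    simp at this ⊢; omega

@[fun_prop]
theorem poly_contract {W : α → List (ℕ × ℕ × ℕ)} {e : α → ℕ × ℕ × ℕ} (hW : PolyTime W)
    (he : PolyTime e) : PolyTime fun a => contract (W a) (e a) :=
  PolyTime.map (f := fun a (x : ℕ × ℕ × ℕ) => bif x.1 == (e a).2.1 then
    (x.1, x.2.1 + min (lookup (W a) (e a).1).1 ((lookup (W a) (e a).1).2 + (e a).2.2),
      x.2.2 + min (lookup (W a) (e a).1).2 ((lookup (W a) (e a).1).1 + (e a).2.2)) else x) hW
    (by fun_prop)

/-- The entries of a table of costs are bounded. -/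
def TableBound (s k : ℕ) (W : List (ℕ × ℕ × ℕ)) : Prop :=
  ∀ x ∈ W, size x.1 ≤ s ∧ x.2.1 < 2 ^ k ∧ x.2.2 < 2 ^ k

theorem TableBound.size_le {s k : ℕ} {W : List (ℕ × ℕ × ℕ)} (h : TableBound s k W) :
    size W ≤ W.length * (s + 4 * k + 5) + 1 :=
  size_list_le fun x hx => by
    obtain ⟨h1, h2, h3⟩ := h x hx
    have h4 := size_le_of_lt_two_pow h2
    have h5 := size_le_of_lt_two_pow h3
    simp; omega

theorem TableBound.lookup_lt {s k : ℕ} {W : List (ℕ × ℕ × ℕ)} (h : TableBound s k W) (v : ℕ) :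
    (lookup W v).1 < 2 ^ k ∧ (lookup W v).2 < 2 ^ k := by
  rcases lookup_mem W v with h' | ⟨x, hx, h'⟩
  · simp [h']
  · rw [h']; exact (h x hx).2

/-- A new entry is at most the sum of two old ones, because the minimum is bounded by its first
argument. Entries at most double, hence their lengths grow only linearly with the number of
contractions. -/
theorem TableBound.contract {s k : ℕ} {W : List (ℕ × ℕ × ℕ)} (h : TableBound s k W)
    (e : ℕ × ℕ × ℕ) : TableBound s (k + 1) (contract W e) := by
  intro x hx
  simp only [TreeFlow.contract, List.mem_map] at hx
  obtain ⟨y, hy, rfl⟩ := hx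
  obtain ⟨h1, h2, h3⟩ := h y hy
  obtain ⟨h4, h5⟩ := h.lookup_lt e.1
  have h6 := min_le_left (lookup W e.1).1 ((lookup W e.1).2 + e.2.2)
  have h7 := min_le_left (lookup W e.1).2 ((lookup W e.1).1 + e.2.2)
  rw [pow_succ]
  cases y.1 == e.2.1
  · exact ⟨h1, by simp only [cond_false]; omega, by simp only [cond_false]; omega⟩
  · exact ⟨h1, by simp only [cond_true]; omega, by simp only [cond_true]; omega⟩

theorem TableBound.foldl {s : ℕ} (l : List (ℕ × ℕ × ℕ)) : ∀ {k : ℕ} {W : List (ℕ × ℕ × ℕ)},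
    TableBound s k W → TableBound s (k + l.length) (l.foldl TreeFlow.contract W) ∧
      (l.foldl TreeFlow.contract W).length = W.length := by
  induction l with
  | nil => exact fun h => ⟨h, rfl⟩
  | cons e l ih =>
    intro k W h
    obtain ⟨h1, h2⟩ := ih (h.contract e)
    refine ⟨?_, by simpa [TreeFlow.contract] using h2⟩
    simpa [add_assoc, add_comm 1] using h1

theorem tableBound_size (W : List (ℕ × ℕ × ℕ)) : TableBound (size W) (size W) W := by
  intro x hx
  have h := size_le_of_mem hx
  simp only [size_pair] at h
  exact ⟨by omega, lt_two_pow_of_size_le (by omega), lt_two_pow_of_size_le (by omega)⟩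

@[fun_prop]
theorem poly_foldl_contract {W O : α → List (ℕ × ℕ × ℕ)} (hW : PolyTime W) (hO : PolyTime O) :
    PolyTime fun a => (O a).foldl contract (W a) := by
  refine PolyTime.foldl (f := fun _ W e => contract W e) hO hW (by fun_prop)
    (g := fun a => size (W a) * (size (W a) + 4 * (size (W a) + size (O a)) + 5) + 1) ?_
    fun a l hl => ?_
  · have h1 := hW.polyBdd_size
    have h2 := hO.polyBdd_size
    exact (h1.mul ((h1.add ((PolyBdd.const 4).mul (h1.add h2))).add (.const 5))).add (.const 1)
  · obtain ⟨h1, h2⟩ := TableBound.foldl l (tableBound_size (W a))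
    have h3 := length_lt_size (W a)
    have h4 := hl.length_le.trans (length_lt_size (O a)).le
    refine h1.size_le.trans ?_
    rw [h2]
    gcongr

theorem poly_decideFlow : PolyTime decideFlow := by
  have h1 : PolyTime fun w => (parse w).2.1 := poly_parse.snd'.fst'
  have h2 : PolyTime fun w => (parse w).2.2.1 := poly_parse.snd'.snd'.fst'
  have h3 : PolyTime fun w => (parse w).2.2.2.1 := poly_parse.snd'.snd'.snd'.fst'
  have h4 := poly_dens h2
  have h5 : PolyTime fun w => ((edges (parse w).2.2.1).map fun e => e.2.2).sum :=
    PolyTime.sum (PolyTime.map (f := fun _ (e : ℕ × ℕ × ℕ) => e.2.2) (by fun_prop) (by fun_prop))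
  unfold decideFlow cutValue
  fun_prop

end

end TreeFlow

/-! ### From polynomial time functions to machines -/

namespace StackProgram

open Computability Turing TreeCode

/-- Move the main stack to the left stack. -/
def unload : Cmd :=
  .loop .main (fun o => o.isSome) fun o => match o with
    | some s => .push .left s
    | none => .skip

theorem exec_unload (w : List Γ') : ∀ A B C : List Γ',
    Exec unload (st w A B C) (st [] (w.reverse ++ A) B C) (2 * w.length + 1) := by
  induction w with
  | nil =>
    intro A B C
    exact Exec.exit (n := 0) (by simp) (by simpa using Exec.skip _)
  | cons s w ih =>
    intro A B C
    have h := ih (s :: A) B C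
    refine (Exec.again (S' := st w (s :: A) B C) (n := 1) (by simp) ?_
      (by rw [List.reverse_cons, List.append_assoc]; exact h)).mono ?_
    · simpa using Exec.push .left s (st w A B C)
    · simp only [List.length_cons]; omega

/-- Write the symbols on the left stack as a list on the main stack. -/
def reload : Cmd :=
  .loop .left (fun o => o.isSome) fun o => match o with
    | some s => .seq (pushWord (word s)) (.push .main .bra)
    | none => .skip

theorem length_word_symbol (s : Γ') : (word s).length = 5 := by
  rcases s with _ | _ | _ | _ | _ <;> rfl

theorem exec_reload (w : List Γ') : ∀ (v M B C : List Γ'),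
    Exec reload (st (word v ++ M) w B C) (st (word (w.reverse ++ v) ++ M) [] B C)
      (7 * w.length + 1) := by
  induction w with
  | nil =>
    intro v M B C
    exact Exec.exit (n := 0) (by simp) (by simpa using Exec.skip _)
  | cons s w ih =>
    intro v M B C
    have h := ih (s :: v) M B C
    refine (Exec.again (S' := st (word (s :: v) ++ M) w B C) (n := 6) (by simp) ?_
      (by rw [List.reverse_cons, List.append_assoc]; exact h)).mono ?_
    · have h1 := (exec_pushWord (word s) (word v ++ M) w B C).seq (exec_push_main _ _ _ _ .bra)
      rw [length_word_symbol] at h1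
      simpa [word_cons] using h1
    · simp only [List.length_cons]; omega

theorem size_symbols (w : List Γ') : size w = 6 * w.length + 1 := by
  induction w with
  | nil => rfl
  | cons s w ih =>
    have : size s = 5 := length_word_symbol s
    simp [ih]; omega

/-- Decision procedures on words that run in polynomial time give rise to machines. -/
theorem computableInPolyTime_of_polyTime {α : Type} (e : α → List Γ') (f : α → Bool)
    {F : List Γ' → Bool} (hF : PolyTime F) (h : ∀ a, F (e a) = f a) :
    Nonempty (TM2ComputableInPolyTime e encodeBool f) := by
  obtain ⟨c, g, ⟨p, hp⟩, hc⟩ := hF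
  -- For a word of length n: 2n + 1 steps to unload it, one push for the empty list, 7n + 1 steps to
  -- write the coded list in the original order, and then `c` on an input of size 6n + 1.
  refine computableInPolyTime e f (.seq unload (.seq (.push .main (.bit false)) (.seq reload c)))
    ((.C 2 * .X + 1) + (1 + ((.C 7 * .X + 1) + p.comp (.C 6 * .X + 1)))) fun a => ?_
  have h1 := (exec_unload (e a) [] [] []).seq ((exec_push_main [] _ [] [] (.bit false)).seq
    ((exec_reload ((e a).reverse ++ []) [] [] [] []).seq
      ((by simpa using hc (e a) [] [] [] [] :
        Exec c _ (st (word (F (e a))) [] [] []) (g (e a))).mono (hp _))))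
  rw [h, size_symbols] at h1
  simpa [Exec, st_init, word_bool] using h1

end StackProgram

/-! ### Flows on acyclic networks -/

namespace FactsNetwork

variable {V E : Type*}

/-- On an acyclic network every difference of phase angles can be prescribed. -/
theorem exists_potential [Finite E] (N : FactsNetwork V E) (hN : N.graph.IsAcyclic) (d : E → ℝ) :
    ∃ θ : V → ℝ, ∀ e, θ (N.dst e) - θ (N.src e) = d e := by
  classical
  have := Fintype.ofFinite E
  suffices h : ∀ F : Finset E, ∃ θ : V → ℝ, ∀ e ∈ F, θ (N.dst e) - θ (N.src e) = d e by
    obtain ⟨θ, hθ⟩ := h Finset.univ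
    exact ⟨θ, fun e => hθ e (Finset.mem_univ e)⟩
  intro F
  induction F using Finset.induction_on with
  | empty => exact ⟨fun _ => 0, by simp⟩
  | insert e F he ih =>
    obtain ⟨θ, hθ⟩ := ih
    -- The graph of the lines treated so far.
    let G : SimpleGraph V := .fromEdgeSet {x | ∃ e' ∈ F, s(N.src e', N.dst e') = x}
    have hadj : ∀ e' ∈ F, G.Adj (N.src e') (N.dst e') := fun e' he' =>
      ⟨⟨e', he', rfl⟩, N.src_ne_dst e'⟩
    -- The new line is a bridge of the whole graph, and `G` lives in what remains without it.
    have hbridge : ¬ G.Reachable (N.src e) (N.dst e) := by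
      have h1 := SimpleGraph.isAcyclic_iff_forall_isBridge.1 hN
        (e := s(N.src e, N.dst e)) ⟨e, rfl⟩
      rw [SimpleGraph.isBridge_iff] at h1
      refine fun h => h1 (h.mono fun a b hab => ?_)
      obtain ⟨⟨e', he', h2⟩, h3⟩ := hab
      refine ⟨⟨e', h2⟩, fun h4 => he ?_⟩
      have h5 : s(a, b) = s(N.src e, N.dst e) := h4.1
      rwa [← N.simple e' e (h2.trans h5)]
    -- Shifting the whole component of `N.dst e` corrects the difference along `e` and leaves those
    -- along the lines of `F` unchanged.
    refine ⟨fun v => θ v + if G.Reachable (N.dst e) v then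
      d e - (θ (N.dst e) - θ (N.src e)) else 0, fun e' he' => ?_⟩
    rcases Finset.mem_insert.1 he' with rfl | he'
    · beta_reduce
      rw [if_pos SimpleGraph.Reachable.rfl, if_neg fun h => hbridge h.symm]
      ring
    · have h1 : G.Reachable (N.dst e) (N.dst e') ↔ G.Reachable (N.dst e) (N.src e') :=
        ⟨fun h => h.trans (hadj e' he').symm.reachable, fun h => h.trans (hadj e' he').reachable⟩
      simp only [h1, ← hθ e' he']
      ring

/-- Positive susceptances turn every classical flow of an acyclic network into a solution. -/
theorem exists_isSolution [Fintype E] (N : FactsNetwork V E) (hN : N.graph.IsAcyclic)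
    {sus f : E → ℝ} {g l : V → ℝ} (hsus : ∀ e, sus e ∈ Set.Icc (N.susLo e) (N.susHi e))
    (hf : N.IsClassicalFlow f g l) (h0 : ∀ e, sus e = 0 → f e = 0) :
    ∃ θ : V → ℝ, N.IsSolution sus θ f g l := by
  -- For susceptance zero the quotient is a meaningless `0`, but there both sides of the power law
  -- vanish anyway.
  obtain ⟨θ, hθ⟩ := N.exists_potential hN fun e => f e / sus e
  refine ⟨θ, ⟨hf, fun e => ?_, hsus⟩⟩
  rw [hθ e]
  by_cases he : sus e = 0
  · simp [he, h0 e he]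
  · field_simp

/-! ### Compactness and attained maxima -/

open Classical in
theorem kirchhoff_iff [Fintype E] (N : FactsNetwork V E) (f : E → ℝ) (g l : V → ℝ) :
    N.Kirchhoff f g l ↔ ∀ a,
      ∑ e, ((if N.src e = a then f e else 0) - if N.dst e = a then f e else 0) = g a - l a := by
  simp only [Kirchhoff, Finset.sum_sub_distrib, Finset.sum_filter]

theorem IsClassicalFlow.abs_sub_le [Fintype E] {N : FactsNetwork V E} {f : E → ℝ} {g l : V → ℝ}
    (h : N.IsClassicalFlow f g l) (a : V) : |g a - l a| ≤ ∑ e, N.cap e := by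
  classical
  rw [← (N.kirchhoff_iff f g l).1 h.kirchhoff a]
  refine (Finset.abs_sum_le_sum_abs _ _).trans (Finset.sum_le_sum fun e _ => ?_)
  have h1 := h.abs_le_cap e
  have h2 := N.cap_nonneg e
  have h3 := N.src_ne_dst e
  split_ifs with h4 h5 h5
  · exact absurd (h4.trans h5.symm) h3
  all_goals simpa

/-- A generator carries no load, so its generation is its net outflow. The bound serves compactness
and, later, the replacement of infinite costs by the total capacity. -/
theorem IsClassicalFlow.gen_le [Fintype E] {N : FactsNetwork V E} {f : E → ℝ} {g l : V → ℝ}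
    (h : N.IsClassicalFlow f g l) (a : V) : g a ≤ ∑ e, N.cap e := by
  by_cases ha : a ∈ N.generators
  · have h1 := (le_abs_self _).trans (h.abs_sub_le a)
    rwa [h.load_eq_zero a fun h2 => Set.disjoint_left.1 N.disjoint ha h2, sub_zero] at h1
  · rw [h.gen_eq_zero a ha]
    exact Finset.sum_nonneg fun e _ => N.cap_nonneg e

theorem IsClassicalFlow.load_le [Fintype E] {N : FactsNetwork V E} {f : E → ℝ} {g l : V → ℝ}
    (h : N.IsClassicalFlow f g l) (a : V) : l a ≤ ∑ e, N.cap e := by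
  by_cases ha : a ∈ N.loads
  · have h1 := (neg_le_abs _).trans (h.abs_sub_le a)
    rwa [h.gen_eq_zero a fun h2 => Set.disjoint_left.1 N.disjoint h2 ha, zero_sub, neg_neg] at h1
  · rw [h.load_eq_zero a ha]
    exact Finset.sum_nonneg fun e _ => N.cap_nonneg e

/-- The total generations of the classical flows that vanish on `Z`. -/
def zeroValues [Fintype V] [Fintype E] (N : FactsNetwork V E) (Z : Set E) : Set ℝ :=
  {r | ∃ f g l, N.IsClassicalFlow f g l ∧ (∀ e ∈ Z, f e = 0) ∧ ∑ a, g a = r}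

/-- All conditions are closed, capacities and `gen_le`, `load_le` confine the flows to a box, and
the zero flow is admissible; a continuous function attains its maximum on such a set. -/
theorem isGreatest_zeroValues [Fintype V] [Fintype E] (N : FactsNetwork V E) (Z : Set E) :
    IsGreatest (N.zeroValues Z) (sSup (N.zeroValues Z)) := by
  classical
  let K : Set ((E → ℝ) × (V → ℝ) × (V → ℝ)) :=
    {x | N.IsClassicalFlow x.1 x.2.1 x.2.2 ∧ ∀ e ∈ Z, x.1 e = 0}
  have himage : N.zeroValues Z = (fun x => ∑ a, x.2.1 a) '' K := by
    ext r
    constructor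
    · rintro ⟨f, g, l, h, h0, rfl⟩
      exact ⟨(f, g, l), ⟨h, h0⟩, rfl⟩
    · rintro ⟨⟨f, g, l⟩, ⟨h, h0⟩, rfl⟩
      exact ⟨f, g, l, h, h0, rfl⟩
  have hclosed : IsClosed K := by
    have : K = {x | (∀ a, 0 ≤ x.2.1 a) ∧ (∀ a, a ∉ N.generators → x.2.1 a = 0) ∧
        (∀ a, 0 ≤ x.2.2 a) ∧ (∀ a, a ∉ N.loads → x.2.2 a = 0) ∧
        (∀ a, ∑ e, ((if N.src e = a then x.1 e else 0) - if N.dst e = a then x.1 e else 0) =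
          x.2.1 a - x.2.2 a) ∧ (∀ e, |x.1 e| ≤ N.cap e) ∧ ∀ e ∈ Z, x.1 e = 0} := by
      ext x
      constructor
      · rintro ⟨⟨h1, h2, h3, h4, h5, h6⟩, h7⟩
        exact ⟨h1, h2, h3, h4, (N.kirchhoff_iff _ _ _).1 h5, h6, h7⟩
      · rintro ⟨h1, h2, h3, h4, h5, h6, h7⟩
        exact ⟨⟨h1, h2, h3, h4, (N.kirchhoff_iff _ _ _).2 h5, h6⟩, h7⟩
    rw [this]
    have hsum : ∀ a, Continuous fun x : (E → ℝ) × (V → ℝ) × (V → ℝ) =>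
        ∑ e, ((if N.src e = a then x.1 e else 0) - if N.dst e = a then x.1 e else 0) := by
      refine fun a => continuous_finsetSum _ fun e _ => Continuous.sub ?_ ?_ <;> split_ifs <;>
        fun_prop
    simp only [Set.ofPred_and, Set.ofPred_forall]
    refine IsClosed.inter ?_ (IsClosed.inter ?_ (IsClosed.inter ?_ (IsClosed.inter ?_
      (IsClosed.inter ?_ (IsClosed.inter ?_ ?_)))))
    · exact isClosed_iInter fun a => isClosed_le (by fun_prop) (by fun_prop)
    · exact isClosed_iInter fun a => isClosed_iInter fun _ => isClosed_eq (by fun_prop) (by fun_prop)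
    · exact isClosed_iInter fun a => isClosed_le (by fun_prop) (by fun_prop)
    · exact isClosed_iInter fun a => isClosed_iInter fun _ => isClosed_eq (by fun_prop) (by fun_prop)
    · exact isClosed_iInter fun a => isClosed_eq (hsum a) (by fun_prop)
    · exact isClosed_iInter fun a => isClosed_le (by fun_prop) (by fun_prop)
    · exact isClosed_iInter fun a => isClosed_iInter fun _ => isClosed_eq (by fun_prop) (by fun_prop)
  have hcompact : IsCompact K := by
    refine IsCompact.of_isClosed_subset ((isCompact_univ_pi fun e => isCompact_Icc
      (a := -N.cap e) (b := N.cap e)).prod ((isCompact_univ_pi fun _ => isCompact_Icc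
      (a := (0 : ℝ)) (b := ∑ e, N.cap e)).prod (isCompact_univ_pi fun _ => isCompact_Icc
      (a := (0 : ℝ)) (b := ∑ e, N.cap e)))) hclosed ?_
    rintro ⟨f, g, l⟩ ⟨h, -⟩
    exact ⟨fun e _ => abs_le.1 (h.abs_le_cap e), fun a _ => ⟨h.gen_nonneg a, h.gen_le a⟩,
      fun a _ => ⟨h.load_nonneg a, h.load_le a⟩⟩
  have hne : K.Nonempty := by
    refine ⟨(0, 0, 0), ⟨⟨?_, ?_, ?_, ?_, ?_, ?_⟩, ?_⟩⟩ <;>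
      simp [Kirchhoff, N.cap_nonneg]
  rw [himage]
  exact (hcompact.image (by fun_prop)).isGreatest_sSup (hne.image _)

/-! ### Reduction of solutions and switching to classical flows -/

theorem classicalValues_eq [Fintype V] [Fintype E] (N : FactsNetwork V E) :
    N.classicalValues = N.zeroValues ∅ := by
  simp [classicalValues, zeroValues]

/-- If `susHi e` is zero, so is the susceptance, and the power law forces `f e = 0`. Conversely the
choice `sus = N.susHi` realises every flow that vanishes on these lines. -/
theorem generationValues_eq [Fintype V] [Fintype E] (N : FactsNetwork V E)
    (hN : N.graph.IsAcyclic) : N.generationValues = N.zeroValues {e | N.susHi e = 0} := by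
  ext r
  constructor
  · rintro ⟨sus, θ, f, g, l, h, rfl⟩
    refine ⟨f, g, l, h.toIsClassicalFlow, fun e he => ?_, rfl⟩
    have h1 := h.sus_mem e
    rw [Set.mem_ofPred_eq] at he
    rw [he] at h1
    rw [h.powerLaw e, le_antisymm h1.2 ((N.susLo_nonneg e).trans h1.1), zero_mul]
  · rintro ⟨f, g, l, h, h0, rfl⟩
    obtain ⟨θ, hθ⟩ := N.exists_isSolution hN (sus := N.susHi)
      (fun e => ⟨N.susLo_le_susHi e, le_rfl⟩) h h0
    exact ⟨_, θ, f, g, l, hθ, rfl⟩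

theorem graph_remove_le (N : FactsNetwork V E) (W : Set E) : (N.remove W).graph ≤ N.graph :=
  fun _ _ ⟨e, he⟩ => ⟨e, he⟩

/-- A flow extends by zero over the removed lines. -/
theorem zeroValues_remove_subset [Fintype V] [Fintype E] (N : FactsNetwork V E) (W : Set E)
    [Fintype {e // e ∉ W}] :
    (N.remove W).zeroValues {e | (N.remove W).susHi e = 0} ⊆ N.zeroValues {e | N.susHi e = 0} := by
  classical
  rintro _ ⟨f, g, l, h, h0, rfl⟩
  have hsum : ∀ F : E → ℝ, (∀ e ∈ W, F e = 0) → ∑ e, F e = ∑ e : {e // e ∉ W}, F e := by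
    intro F hF
    rw [← Finset.sum_subtype (Finset.univ.filter fun e => e ∉ W) (by simp),
      Finset.sum_filter_of_ne]
    exact fun e _ he hW => he (hF e hW)
  refine ⟨fun e => if he : e ∈ W then 0 else f ⟨e, he⟩, g, l, ⟨h.gen_nonneg, h.gen_eq_zero,
    h.load_nonneg, h.load_eq_zero, ?_, fun e => ?_⟩, fun e he => ?_, rfl⟩
  · rw [kirchhoff_iff]
    intro a
    rw [← ((N.remove W).kirchhoff_iff f g l).1 h.kirchhoff a, hsum]
    · refine Finset.sum_congr rfl fun e _ => ?_
      simp only [e.2, dite_false]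
      rfl
    · intro e he
      simp [he]
  · by_cases hW : e ∈ W
    · simpa [hW] using N.cap_nonneg e
    · simp only [hW, dite_false]
      exact h.abs_le_cap ⟨e, hW⟩
  · by_cases hW : e ∈ W
    · simp [hW]
    · simpa [hW] using h0 ⟨e, hW⟩ he

theorem zeroValues_subset_remove [Fintype V] [Fintype E] (N : FactsNetwork V E)
    [Fintype {e // e ∉ (∅ : Set E)}] : N.zeroValues {e | N.susHi e = 0} ⊆
      (N.remove ∅).zeroValues {e | (N.remove ∅).susHi e = 0} := by
  classical
  rintro _ ⟨f, g, l, h, h0, rfl⟩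
  refine ⟨fun e => f e, g, l, ⟨h.gen_nonneg, h.gen_eq_zero, h.load_nonneg, h.load_eq_zero, ?_,
    fun e => h.abs_le_cap e⟩, fun e he => h0 e he, rfl⟩
  rw [kirchhoff_iff]
  intro a
  rw [← (N.kirchhoff_iff f g l).1 h.kirchhoff a]
  exact Fintype.sum_equiv (Equiv.subtypeUnivEquiv (p := fun e => e ∉ (∅ : Set E)) (by simp)) _ _
    fun e => rfl

theorem switchingValues_eq [Fintype V] [Fintype E] (N : FactsNetwork V E)
    (hN : N.graph.IsAcyclic) : N.switchingValues = N.generationValues := by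
  classical
  refine Set.Subset.antisymm ?_ ?_
  · rintro r ⟨W, hr⟩
    rw [generationValues_eq _ hN]
    exact N.zeroValues_remove_subset W
      ((Set.ext_iff.1 (generationValues_eq _ (hN.anti (N.graph_remove_le W))) r).1 hr)
  · intro r hr
    refine ⟨∅, ?_⟩
    rw [generationValues_eq _ hN] at hr
    convert (Set.ext_iff.1 (generationValues_eq _ (hN.anti (N.graph_remove_le ∅))) r).2
      (N.zeroValues_subset_remove hr)

theorem isGreatest_generationValues [Fintype V] [Fintype E] (N : FactsNetwork V E)
    (hN : N.graph.IsAcyclic) : IsGreatest N.generationValues N.mff := by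
  unfold mff
  rw [N.generationValues_eq hN]
  exact N.isGreatest_zeroValues _

/-- Each maximum of a switched network is attained, hence a switching value and so a generation
value of `N`; conversely the largest generation value occurs for some `W`. -/
theorem msf_eq_mff [Fintype V] [Fintype E] (N : FactsNetwork V E) (hN : N.graph.IsAcyclic) :
    N.msf = N.mff := by
  classical
  have h1 := N.isGreatest_generationValues hN
  have h2 : ∀ W : Set E, (N.remove W).mpf ≤ N.mff := fun W => h1.2 <| by
    rw [← N.switchingValues_eq hN]
    refine ⟨W, ?_⟩
    exact ((N.remove W).isGreatest_generationValues (hN.anti (N.graph_remove_le W))).1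
  have h3 : N.mff ∈ N.switchingValues := by
    rw [N.switchingValues_eq hN]; exact h1.1
  obtain ⟨W, hW⟩ := h3
  refine le_antisymm (ciSup_le h2) (le_ciSup_of_le ⟨N.mff, ?_⟩ W ?_)
  · rintro _ ⟨W, rfl⟩
    exact h2 W
  · exact ((N.remove W).isGreatest_generationValues (hN.anti (N.graph_remove_le W))).2 hW

/-- The flows of an acyclic network. -/
theorem acyclic_flows [Fintype V] [Fintype E] (N : FactsNetwork V E) (hN : N.graph.IsAcyclic) :
    (∀ (sus f : E → ℝ) (g l : V → ℝ),
      (∀ e, sus e ∈ Set.Icc (N.susLo e) (N.susHi e)) → (∀ e, 0 < sus e) →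
      N.IsClassicalFlow f g l → ∃ θ : V → ℝ, N.IsSolution sus θ f g l) ∧
    IsGreatest N.classicalValues N.maxFlow ∧
    IsGreatest N.generationValues N.mff ∧
    (N.IsLDC → IsGreatest N.switchingValues N.msf) ∧
    ((∀ e, 0 < N.susHi e) → N.mff = N.maxFlow ∧ (N.IsLDC → N.msf = N.maxFlow)) := by
  have h1 := N.isGreatest_generationValues hN
  refine ⟨fun sus f g l hsus hpos hf => N.exists_isSolution hN hsus hf fun e he =>
    absurd he (hpos e).ne', ?_, h1, fun _ => ?_, fun hpos => ?_⟩
  · unfold maxFlow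
    rw [classicalValues_eq]
    exact N.isGreatest_zeroValues _
  · rw [N.msf_eq_mff hN, N.switchingValues_eq hN]
    exact h1
  · have h2 : N.mff = N.maxFlow := by
      have h3 : {e | N.susHi e = 0} = ∅ := Set.eq_empty_of_forall_notMem fun e he => (hpos e).ne' he
      rw [mff, maxFlow, N.generationValues_eq hN, classicalValues_eq, h3]
    exact ⟨h2, fun _ => (N.msf_eq_mff hN).trans h2⟩

end FactsNetwork

/-! ### Maximum flows and minimum cuts of trees -/

namespace FactsNetwork

variable {V E : Type*}

/-- The nodes of a list of lines `(child, parent, line)` with root `r`. -/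
def verts (r : V) (O : List (V × V × E)) : List V :=
  O.map (fun x => x.1) ++ [r]

@[simp]
theorem verts_nil (r : V) : verts (E := E) r [] = [r] := rfl

@[simp]
theorem verts_cons (r : V) (x : V × V × E) (O : List (V × V × E)) :
    verts r (x :: O) = x.1 :: verts r O := rfl

/-- A list of lines `(child, parent, line)` in which every parent comes after its children. -/
def Rooted (N : FactsNetwork V E) (r : V) : List (V × V × E) → Prop
  | [] => True
  | x :: O => x.1 ∉ verts r O ∧ x.2.1 ∈ verts r O ∧
      s(N.src x.2.2, N.dst x.2.2) = s(x.1, x.2.1) ∧ N.Rooted r O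

theorem Rooted.nodup_verts {N : FactsNetwork V E} {r : V} {O : List (V × V × E)}
    (h : N.Rooted r O) : (verts r O).Nodup := by
  induction O with
  | nil => simp
  | cons x O ih => exact List.nodup_cons.2 ⟨h.1, ih h.2.2.2⟩

theorem Rooted.ends_mem {N : FactsNetwork V E} {r : V} {O : List (V × V × E)}
    (h : N.Rooted r O) {x : V × V × E} (hx : x ∈ O) :
    N.src x.2.2 ∈ verts r O ∧ N.dst x.2.2 ∈ verts r O := by
  induction O with
  | nil => simp at hx
  | cons y O ih =>
    obtain ⟨-, h2, h3, h4⟩ := h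
    rcases List.mem_cons.1 hx with rfl | hx
    · rcases Sym2.eq_iff.1 h3 with ⟨h5, h6⟩ | ⟨h5, h6⟩ <;> simp [h5, h6, h2]
    · obtain ⟨h5, h6⟩ := ih h4 hx
      simp [h5, h6]

/-- The child of a line is an end of no line further down the list. -/
theorem Rooted.nodup_lines {N : FactsNetwork V E} {r : V} {O : List (V × V × E)}
    (h : N.Rooted r O) : (O.map fun x => x.2.2).Nodup := by
  induction O with
  | nil => simp
  | cons x O ih =>
    refine List.nodup_cons.2 ⟨fun hx => ?_, ih h.2.2.2⟩
    obtain ⟨y, hy, hxy⟩ := List.mem_map.1 hx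
    obtain ⟨h1, h2⟩ := h.2.2.2.ends_mem hy
    rw [hxy] at h1 h2
    rcases Sym2.eq_iff.1 h.2.2.1 with ⟨h5, -⟩ | ⟨-, h6⟩
    · exact h.1 (h5 ▸ h1)
    · exact h.1 (h6 ▸ h2)

section

variable [DecidableEq V] {R : Type*} [LinearOrder R] [AddCommMonoid R]

/-- The value of a minimum cut, computed by contracting leaves.  A node `u` on the source side
costs `A u`, a node `u` on the sink side costs `B u`. -/
def treeCut (r : V) (c : E → R) : List (V × V × E) → (V → R) → (V → R) → R
  | [], A, B => min (A r) (B r)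
  | x :: O, A, B => treeCut r c O
      (fun u => A u + if u = x.2.1 then min (A x.1) (B x.1 + c x.2.2) else 0)
      (fun u => B u + if u = x.2.1 then min (B x.1) (A x.1 + c x.2.2) else 0)

end

theorem treeCut_natCast [DecidableEq V] (r : V) (c : E → ℕ) (O : List (V × V × E)) :
    ∀ A B : V → ℕ, ((treeCut r c O A B : ℕ) : ℝ) =
      treeCut r (fun e => (c e : ℝ)) O (fun u => (A u : ℝ)) (fun u => (B u : ℝ)) := by
  induction O with
  | nil => intro A B; simp [treeCut]
  | cons x O ih =>
    intro A B
    rw [treeCut, treeCut, ih]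
    congr 1 <;> funext u <;> split_ifs <;> simp

variable [DecidableEq V]

theorem treeCut_congr (N : FactsNetwork V E) {r : V} (c : E → ℝ) {O : List (V × V × E)}
    (hO : N.Rooted r O) : ∀ {A B A' B' : V → ℝ}, (∀ u ∈ verts r O, A u = A' u) →
    (∀ u ∈ verts r O, B u = B' u) → treeCut r c O A B = treeCut r c O A' B' := by
  induction O with
  | nil =>
    intro A B A' B' hA hB
    simp [treeCut, hA r (by simp), hB r (by simp)]
  | cons x O ih =>
    intro A B A' B' hA hB
    have hA1 := hA x.1 (by simp)
    have hB1 := hB x.1 (by simp)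
    refine ih hO.2.2.2 (fun u hu => ?_) fun u hu => ?_
    · rw [hA u (by simp [hu]), hA1, hB1]
    · rw [hB u (by simp [hu]), hA1, hB1]

/-- Every cut puts `p` on one of the two sides and so becomes dearer by exactly `m`; in the
recursion, contracting `p` hands the amount `m` to its parent. -/
theorem treeCut_add (N : FactsNetwork V E) {r : V} (c : E → ℝ) {O : List (V × V × E)}
    (hO : N.Rooted r O) (m : ℝ) : ∀ (A B : V → ℝ) (p : V), p ∈ verts r O →
    treeCut r c O (fun u => A u + if u = p then m else 0) (fun u => B u + if u = p then m else 0) =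
      treeCut r c O A B + m := by
  induction O with
  | nil =>
    intro A B p hp
    obtain rfl : p = r := by simpa using hp
    simp [treeCut, min_add_add_right]
  | cons x O ih =>
    intro A B p hp
    obtain ⟨h1, h2, -, h4⟩ := hO
    rcases List.mem_cons.1 hp with rfl | hp
    · rw [treeCut, treeCut, ← ih h4 _ _ x.2.1 h2]
      have hne : ∀ u ∈ verts r O, u ≠ x.1 := fun u hu h => h1 (h ▸ hu)
      refine N.treeCut_congr c h4 (fun u hu => ?_) fun u hu => ?_
      all_goals
        simp only [hne u hu, if_false, if_true, add_zero]
        split_ifs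
        · rw [add_right_comm _ m, min_add_add_right]; ring
        · ring
    · rw [treeCut, treeCut, ← ih h4 _ _ p hp]
      have hpx : x.1 ≠ p := fun h => h1 (h ▸ hp)
      simp only [hpx, if_false, add_zero, add_right_comm]

/-- The contribution of the line `e` to the net outflow of `u`. -/
def outflow (N : FactsNetwork V E) (f : E → ℝ) (u : V) (e : E) : ℝ :=
  (if N.src e = u then f e else 0) - if N.dst e = u then f e else 0

theorem outflow_congr (N : FactsNetwork V E) {f f' : E → ℝ} {e : E} (h : f e = f' e) (u : V) :
    N.outflow f u e = N.outflow f' u e := by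
  rw [outflow, outflow, h]

theorem sum_map_ite {p : V} {y : ℝ} {l : List V} (h : l.Nodup) (hp : p ∈ l) :
    (l.map fun u => if u = p then y else 0).sum = y := by
  induction l with
  | nil => simp at hp
  | cons a l ih =>
    obtain ⟨h1, h2⟩ := List.nodup_cons.1 h
    rw [List.map_cons, List.sum_cons]
    rcases List.mem_cons.1 hp with rfl | hp
    · have h3 : (l.map fun u => if u = p then y else 0) = l.map fun _ => 0 :=
        List.map_congr_left fun u hu => if_neg (by rintro rfl; exact h1 hu)
      rw [h3]; simp
    · rw [ih h2 hp, if_neg (by rintro rfl; exact h1 hp), zero_add]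

/-- The value of a minimum cut is attained by a flow. -/
theorem exists_flow (N : FactsNetwork V E) {r : V} {c : E → ℝ} (hc : ∀ e, 0 ≤ c e)
    {O : List (V × V × E)} (hO : N.Rooted r O) : ∀ {A B : V → ℝ}, (∀ u, 0 ≤ A u) →
    (∀ u, 0 ≤ B u) → ∃ (f : E → ℝ) (g l : V → ℝ), (∀ e, |f e| ≤ c e) ∧
      (∀ u, 0 ≤ g u ∧ g u ≤ B u) ∧ (∀ u, 0 ≤ l u ∧ l u ≤ A u) ∧
      (∀ u ∈ verts r O, (O.map fun x => N.outflow f u x.2.2).sum = g u - l u) ∧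
      ((verts r O).map g).sum = treeCut r c O A B := by
  classical
  induction O with
  | nil =>
    intro A B hA hB
    have h0 : ∀ u, 0 ≤ min (A u) (B u) := fun u => le_min (hA u) (hB u)
    exact ⟨fun _ => 0, fun u => min (A u) (B u), fun u => min (A u) (B u), by simpa using hc,
      fun u => ⟨h0 u, min_le_right _ _⟩, fun u => ⟨h0 u, min_le_left _ _⟩, by simp,
      by simp [treeCut]⟩
  | cons x O ih =>
    intro A B hA hB
    obtain ⟨v, p, e⟩ := x
    have hO' := hO
    obtain ⟨h1, h2, h3, h4⟩ := hO
    simp only at h1 h2 h3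
    have hvp : v ≠ p := fun h => h1 (h ▸ h2)
    have hnd := h4.nodup_verts
    -- The amount of generation that is consumed at the leaf `v` itself.
    obtain ⟨m, hm⟩ : ∃ m, m = min (A v) (B v) := ⟨_, rfl⟩
    have hmA : m ≤ A v := hm ▸ min_le_left _ _
    have hmB : m ≤ B v := hm ▸ min_le_right _ _
    have hm0 : 0 ≤ m := hm ▸ le_min (hA v) (hB v)
    have hce := hc e
    have ha : 0 ≤ min (A v - m) (c e) := le_min (by linarith) hce
    have hb : 0 ≤ min (B v - m) (c e) := le_min (by linarith) hce
    -- After that at most one of `A v - m` and `B v - m` is positive. The part the line can carry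
    -- becomes an extra allowance of load or generation at `p`.
    obtain ⟨f, g, l, hf, hg, hl, hk, hs⟩ := ih h4
      (A := fun u => A u + if u = p then min (A v - m) (c e) else 0)
      (B := fun u => B u + if u = p then min (B v - m) (c e) else 0)
      (fun u => add_nonneg (hA u) (by split_ifs <;> [exact ha; rfl]))
      (fun u => add_nonneg (hB u) (by split_ifs <;> [exact hb; rfl]))
    have hval : treeCut r c ((v, p, e) :: O) A B = treeCut r c O
        (fun u => A u + if u = p then min (A v - m) (c e) else 0)
        (fun u => B u + if u = p then min (B v - m) (c e) else 0) + m := by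
      rw [treeCut, ← N.treeCut_add c h4 m _ _ p h2]
      have e1 : min (A v) (B v + c e) = min (A v - m) (c e) + m := by
        rcases le_total (A v) (B v) with h | h
        · rw [hm, min_eq_left h, sub_self, min_eq_left hce, zero_add, min_eq_left (by linarith)]
        · rw [hm, min_eq_right h, ← min_add_add_right, sub_add_cancel, add_comm (c e)]
      have e2 : min (B v) (A v + c e) = min (B v - m) (c e) + m := by
        rcases le_total (A v) (B v) with h | h
        · rw [hm, min_eq_left h, ← min_add_add_right, sub_add_cancel, add_comm (c e)]
        · rw [hm, min_eq_right h, sub_self, min_eq_left hce, zero_add, min_eq_left (by linarith)]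
      simp only [e1, e2]
      congr 1 <;> funext u <;> split_ifs <;> ring
    -- `y` and `z` are the parts of the generation and the load of `p` to be moved back to `v`. They
    -- are as large as the allowance permits, so what stays at `p` respects the original bounds; the
    -- line carries `y - z` from `v` to `p`.
    obtain ⟨y, hy⟩ : ∃ y, y = min (g p) (min (B v - m) (c e)) := ⟨_, rfl⟩
    obtain ⟨z, hz⟩ : ∃ z, z = min (l p) (min (A v - m) (c e)) := ⟨_, rfl⟩
    have hgp := hg p
    have hlp := hl p
    simp only [if_true] at hgp hlp
    have hy0 : 0 ≤ y := hy ▸ le_min hgp.1 hb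
    have hz0 : 0 ≤ z := hz ▸ le_min hlp.1 ha
    have hyg : y ≤ g p := hy ▸ min_le_left _ _
    have hzl : z ≤ l p := hz ▸ min_le_left _ _
    have hyb : y ≤ min (B v - m) (c e) := hy ▸ min_le_right _ _
    have hza : z ≤ min (A v - m) (c e) := hz ▸ min_le_right _ _
    have hyB : g p - y ≤ B p := by
      rcases min_choice (g p) (min (B v - m) (c e)) with h | h <;> rw [hy, h]
      · simpa using hB p
      · linarith [hgp.2]
    have hzA : l p - z ≤ A p := by
      rcases min_choice (l p) (min (A v - m) (c e)) with h | h <;> rw [hz, h]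
      · simpa using hA p
      · linarith [hlp.2]
    have hyB' := hyb.trans (min_le_left _ _)
    have hyc := hyb.trans (min_le_right _ _)
    have hzA' := hza.trans (min_le_left _ _)
    have hzc := hza.trans (min_le_right _ _)
    have htail : ∀ x ∈ O, x.2.2 ≠ e := fun x hx h => by
      have h5 := hO'.nodup_lines
      rw [List.map_cons, List.nodup_cons] at h5
      exact h5.1 (List.mem_map.2 ⟨x, hx, h⟩)
    refine ⟨fun e' => if e' = e then (if N.src e = v then y - z else z - y) else f e',
      fun u => if u = v then m + y else g u - if u = p then y else 0,
      fun u => if u = v then m + z else l u - if u = p then z else 0, fun e' => ?_, fun u => ?_,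
      fun u => ?_, fun u hu => ?_, ?_⟩
    · beta_reduce
      by_cases h5 : e' = e
      · rw [if_pos h5, h5, abs_le]; split_ifs <;> constructor <;> linarith
      · rw [if_neg h5]; exact hf e'
    · beta_reduce
      split_ifs with h5 h6
      · rw [h5]; constructor <;> linarith
      · rw [h6]; exact ⟨by linarith, hyB⟩
      · have := hg u
        rw [if_neg h6] at this
        simpa using this
    · beta_reduce
      split_ifs with h5 h6
      · rw [h5]; constructor <;> linarith
      · rw [h6]; exact ⟨by linarith, hzA⟩
      · have := hl u
        rw [if_neg h6] at this
        simpa using this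
    · rw [List.map_cons, List.sum_cons]
      have h5 : (O.map fun x => N.outflow (fun e' => if e' = e then
          (if N.src e = v then y - z else z - y) else f e') u x.2.2) =
          O.map fun x => N.outflow f u x.2.2 :=
        List.map_congr_left fun x hx => N.outflow_congr (if_neg (htail x hx)) u
      have h6 : N.outflow (fun e' => if e' = e then
          (if N.src e = v then y - z else z - y) else f e') u e =
          (if u = v then y - z else 0) - if u = p then y - z else 0 := by
        rw [outflow]
        rcases Sym2.eq_iff.1 h3 with ⟨h7, h8⟩ | ⟨h7, h8⟩
        · simp only [h7, h8, if_true, eq_comm (b := u)]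
        · simp only [h7, h8, if_true, hvp.symm, if_false, eq_comm (b := u)]
          split_ifs <;> ring
      rw [h5, h6]
      by_cases huv : u = v
      · have h7 : (O.map fun x => N.outflow f u x.2.2) = O.map fun _ => 0 := by
          refine List.map_congr_left fun x hx => ?_
          obtain ⟨h8, h9⟩ := h4.ends_mem hx
          rw [outflow, if_neg, if_neg, sub_zero]
          · rintro rfl; exact h1 (huv ▸ h9)
          · rintro rfl; exact h1 (huv ▸ h8)
        rw [h7]
        simp only [huv, if_true, hvp, if_false]
        simp
      · rw [hk u ((List.mem_cons.1 hu).resolve_left huv)]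
        simp only [huv, if_false]
        split_ifs <;> ring
    · have h5 : ((verts r O).map fun u => if u = v then m + y else g u - if u = p then y else 0) =
          (verts r O).map fun u => g u - if u = p then y else 0 :=
        List.map_congr_left fun u hu => if_neg (by rintro rfl; exact h1 hu)
      rw [verts_cons, List.map_cons, List.sum_cons, h5, if_pos rfl, hval, ← hs]
      have h6 : ((verts r O).map fun u => g u - if u = p then y else 0).sum =
          ((verts r O).map g).sum - ((verts r O).map fun u => if u = p then y else 0).sum := by
        induction verts r O with
        | nil => simp
        | cons a l ih => simp only [List.map_cons, List.sum_cons, ih]; ring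
      rw [h6, sum_map_ite hnd h2]
      ring

/-- The value of a minimum cut is the cost of a labelling of the nodes. -/
theorem exists_cut (N : FactsNetwork V E) {r : V} (c : E → ℝ) {O : List (V × V × E)}
    (hO : N.Rooted r O) : ∀ A B : V → ℝ, ∃ x : V → Bool,
      ((verts r O).map fun u => if x u then A u else B u).sum +
        (O.map fun y => if x (N.src y.2.2) = x (N.dst y.2.2) then 0 else c y.2.2).sum =
      treeCut r c O A B := by
  induction O with
  | nil =>
    intro A B
    refine ⟨fun _ => decide (A r ≤ B r), ?_⟩
    by_cases h : A r ≤ B r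
    · simp [treeCut, h]
    · simp [treeCut, h, le_of_not_ge h]
  | cons y O ih =>
    intro A B
    obtain ⟨v, p, e⟩ := y
    obtain ⟨h1, h2, h3, h4⟩ := hO
    simp only at h1 h2 h3
    have hnd := h4.nodup_verts
    have hvp : p ≠ v := fun h => h1 (h ▸ h2)
    obtain ⟨x, hx⟩ := ih h4 (fun u => A u + if u = p then min (A v) (B v + c e) else 0)
      (fun u => B u + if u = p then min (B v) (A v + c e) else 0)
    -- The leaf takes the side that is cheaper given the side of its parent, the cost of cutting the
    -- line included.
    let b : Bool := if x p then decide (A v ≤ B v + c e) else decide (A v + c e < B v)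
    let x' : V → Bool := fun u => if u = v then b else x u
    have hx' : ∀ u ∈ verts r O, x' u = x u := fun u hu =>
      if_neg (by rintro rfl; exact h1 hu)
    have hxv : x' v = b := if_pos rfl
    have hxp : x' p = x p := hx' p h2
    refine ⟨x', ?_⟩
    have e1 : ((verts r O).map fun u => if x' u then A u else B u) =
        (verts r O).map fun u => if x u then A u else B u :=
      List.map_congr_left fun u hu => by rw [hx' u hu]
    have e2 : (O.map fun y => if x' (N.src y.2.2) = x' (N.dst y.2.2) then 0 else c y.2.2) =
        O.map fun y => if x (N.src y.2.2) = x (N.dst y.2.2) then 0 else c y.2.2 :=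
      List.map_congr_left fun y hy => by
        rw [hx' _ (h4.ends_mem hy).1, hx' _ (h4.ends_mem hy).2]
    have e3 : ((verts r O).map fun u => if x u then
          A u + (if u = p then min (A v) (B v + c e) else 0) else
          B u + if u = p then min (B v) (A v + c e) else 0).sum =
        ((verts r O).map fun u => if x u then A u else B u).sum +
          ((verts r O).map fun u => if u = p then
            (if x p then min (A v) (B v + c e) else min (B v) (A v + c e)) else 0).sum := by
      induction verts r O with
      | nil => simp
      | cons a l ih =>
        simp only [List.map_cons, List.sum_cons, ih]
        by_cases h : a = p
        · subst h; split_ifs <;> ring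
        · simp only [h, if_false]; split_ifs <;> ring
    have e4 : (if x' (N.src e) = x' (N.dst e) then 0 else c e) = if b = x p then 0 else c e := by
      rcases Sym2.eq_iff.1 h3 with ⟨h7, h8⟩ | ⟨h7, h8⟩
      · rw [h7, h8, hxv, hxp]
      · rw [h7, h8, hxv, hxp]; simp only [eq_comm]
    have e5 : (if b then A v else B v) + (if b = x p then 0 else c e) =
        if x p then min (A v) (B v + c e) else min (B v) (A v + c e) := by
      rcases hxp' : x p with _ | _ <;> simp only [b, hxp']
      · by_cases h : A v + c e < B v
        · simp [h, min_eq_right h.le]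
        · simp [h, min_eq_left (not_lt.1 h)]
      · by_cases h : A v ≤ B v + c e
        · simp [h]
        · simp [h, min_eq_right (not_le.1 h).le]
    rw [treeCut, ← hx, e3, sum_map_ite hnd h2, ← e5]
    simp only [verts_cons, List.map_cons, List.sum_cons, e1, e2, e4, hxv]
    ring

/-- The generation of a flow is at most the cost of any labelling. -/
theorem gen_le_cut [Fintype V] [Fintype E] (N : FactsNetwork V E) {c : E → ℝ} {A B : V → ℝ}
    {f : E → ℝ} {g l : V → ℝ} (hf : ∀ e, |f e| ≤ c e) (hg : ∀ u, g u ≤ B u) (hl : ∀ u, l u ≤ A u)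
    (hk : ∀ u, ∑ e, N.outflow f u e = g u - l u) (x : V → Bool) :
    ∑ u, g u ≤ ∑ u, (if x u then A u else B u) +
      ∑ e, if x (N.src e) = x (N.dst e) then 0 else c e := by
  -- On the source side, generation is replaced by load plus net outflow.
  have h1 : ∑ u, g u = ∑ u, (if x u then l u else g u) +
      ∑ u, if x u then ∑ e, N.outflow f u e else 0 := by
    rw [← Finset.sum_add_distrib]
    refine Finset.sum_congr rfl fun u _ => ?_
    rw [hk]
    split_ifs <;> ring
  -- Summed over the source side, lines inside it cancel and only those crossing the cut remain.
  have h2 : ∑ u, (if x u then ∑ e, N.outflow f u e else 0) =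
      ∑ e, ((if x (N.src e) then f e else 0) - if x (N.dst e) then f e else 0) := by
    have h3 : ∀ u, (if x u then ∑ e, N.outflow f u e else 0) =
        ∑ e, ((if N.src e = u then (if x u then f e else 0) else 0) -
          if N.dst e = u then (if x u then f e else 0) else 0) := by
      intro u
      split_ifs
      · rfl
      · simp
    simp only [h3]
    rw [Finset.sum_comm]
    refine Finset.sum_congr rfl fun e _ => ?_
    rw [Finset.sum_sub_distrib]
    simp
  rw [h1, h2]
  refine add_le_add (Finset.sum_le_sum fun u _ => ?_) (Finset.sum_le_sum fun e _ => ?_)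
  · split_ifs
    · exact hl u
    · exact hg u
  · have h3 := abs_le.1 (hf e)
    cases x (N.src e) <;> cases x (N.dst e) <;> simp <;> linarith

open Classical in
/-- The maximum flow of a tree. -/
theorem maxFlow_eq_treeCut [Fintype V] [Fintype E] (N : FactsNetwork V E) {r : V}
    {O : List (V × V × E)} (hO : N.Rooted r O) (hV : ∀ u, u ∈ verts r O)
    (hE : ∀ e, e ∈ O.map fun x => x.2.2) {M : ℝ} (hM : ∑ e, N.cap e ≤ M) :
    N.maxFlow = treeCut r N.cap O (fun u => if u ∈ N.loads then M else 0)
      (fun u => if u ∈ N.generators then M else 0) := by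
  have hsV : ∀ h : V → ℝ, ((verts r O).map h).sum = ∑ u, h u := by
    intro h
    rw [← List.sum_toFinset h hO.nodup_verts]
    exact Finset.sum_congr (Finset.eq_univ_of_forall fun u => List.mem_toFinset.2 (hV u))
      fun _ _ => rfl
  have hsE : ∀ h : E → ℝ, (O.map fun x => h x.2.2).sum = ∑ e, h e := by
    intro h
    have h1 : (O.map fun x => h x.2.2) = (O.map fun x => x.2.2).map h := by simp
    rw [h1, ← List.sum_toFinset h hO.nodup_lines]
    exact Finset.sum_congr (Finset.eq_univ_of_forall fun e => List.mem_toFinset.2 (hE e))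
      fun _ _ => rfl
  have hM0 : 0 ≤ M := (Finset.sum_nonneg fun e _ => N.cap_nonneg e).trans hM
  -- The flow of `exists_flow` attains the value. The cut of `exists_cut` bounds every flow, since
  -- by `gen_le`, `load_le` and `hM` the allowance `M` never restricts anything.
  refine IsGreatest.csSup_eq ⟨?_, ?_⟩
  · obtain ⟨f, g, l, hf, hg, hl, hk, hs⟩ := N.exists_flow N.cap_nonneg hO
      (A := fun u => if u ∈ N.loads then M else 0)
      (B := fun u => if u ∈ N.generators then M else 0)
      (fun u => by split_ifs <;> simp [hM0]) (fun u => by split_ifs <;> simp [hM0])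
    refine ⟨f, g, l, ⟨fun u => (hg u).1, fun u hu => ?_, fun u => (hl u).1, fun u hu => ?_,
      ?_, hf⟩, by rw [← hs, hsV]⟩
    · have := hg u
      rw [if_neg hu] at this
      exact le_antisymm this.2 this.1
    · have := hl u
      rw [if_neg hu] at this
      exact le_antisymm this.2 this.1
    · rw [kirchhoff_iff]
      intro u
      rw [← hk u (hV u), hsE (N.outflow f u)]
      refine Finset.sum_congr rfl fun e _ => ?_
      rw [outflow]
      congr
  · rintro _ ⟨f, g, l, h, rfl⟩
    obtain ⟨x, hx⟩ := N.exists_cut N.cap hO (fun u => if u ∈ N.loads then M else 0)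
      (fun u => if u ∈ N.generators then M else 0)
    rw [← hx, hsV, hsE fun e => if x (N.src e) = x (N.dst e) then 0 else N.cap e]
    refine N.gen_le_cut (A := fun u => if u ∈ N.loads then M else 0)
      (B := fun u => if u ∈ N.generators then M else 0) h.abs_le_cap (fun u => ?_) (fun u => ?_)
      (l := l) (fun u => ?_) x
    · split_ifs with hu
      · exact (h.gen_le u).trans hM
      · exact (h.gen_eq_zero u hu).le
    · split_ifs with hu
      · exact (h.load_le u).trans hM
      · exact (h.load_eq_zero u hu).le
    · rw [← (N.kirchhoff_iff f g l).1 h.kirchhoff u]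
      refine Finset.sum_congr rfl fun e _ => ?_
      rw [outflow]
      congr

end FactsNetwork

/-! ### Searching a tree -/

namespace FactsNetwork

variable {V E : Type*}

theorem card_add_one [Fintype V] [Fintype E] (N : FactsNetwork V E) (hN : N.graph.IsTree) :
    Fintype.card E + 1 = Fintype.card V := by
  classical
  rw [← hN.card_edgeFinset, ← Finset.card_univ]
  congr 1
  refine Finset.card_bij (fun e _ => s(N.src e, N.dst e)) (fun e _ => ?_)
    (fun e _ e' _ h => N.simple e e' h) fun x hx => ?_
  · rw [SimpleGraph.mem_edgeFinset]
    exact ⟨e, rfl⟩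
  · rw [SimpleGraph.mem_edgeFinset] at hx
    induction x using Sym2.ind with
    | h a b =>
      obtain ⟨e, he⟩ := hx
      exact ⟨e, Finset.mem_univ e, he⟩

/-- Counting: the list has one distinct line for each node but the root, and a tree has no more
lines than that. -/
theorem Rooted.mem_lines {N : FactsNetwork V E} {r : V} [Fintype V] [Fintype E]
    {O : List (V × V × E)} (hO : N.Rooted r O) (hN : N.graph.IsTree)
    (hV : ∀ u, u ∈ verts r O) (e : E) : e ∈ O.map fun x => x.2.2 := by
  classical
  have h1 : (verts r O).toFinset = Finset.univ :=
    Finset.eq_univ_of_forall fun u => List.mem_toFinset.2 (hV u)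
  have h2 : (O.map fun x => x.2.2).toFinset = Finset.univ := by
    rw [← Finset.card_eq_iff_eq_univ, List.toFinset_card_of_nodup hO.nodup_lines]
    have h3 := List.toFinset_card_of_nodup hO.nodup_verts
    rw [h1, Finset.card_univ, ← N.card_add_one hN] at h3
    simp [verts] at h3
    simp [h3]
  have h3 := Finset.mem_univ e
  rwa [← h2, List.mem_toFinset] at h3

variable [DecidableEq V]

/-- Add a line to the list if exactly one of its ends has been reached. -/
def growLine (N : FactsNetwork V E) (r : V) (O : List (V × V × E)) (e : E) : List (V × V × E) :=
  if N.src e ∈ verts r O ∧ N.dst e ∉ verts r O then (N.dst e, N.src e, e) :: O else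
    if N.dst e ∈ verts r O ∧ N.src e ∉ verts r O then (N.src e, N.dst e, e) :: O else O

variable {N : FactsNetwork V E} {r : V}

theorem Rooted.growLine {O : List (V × V × E)} (hO : N.Rooted r O) (e : E) :
    N.Rooted r (N.growLine r O e) := by
  unfold FactsNetwork.growLine
  split_ifs with h1 h2
  · exact ⟨h1.2, h1.1, Sym2.eq_swap, hO⟩
  · exact ⟨h2.2, h2.1, rfl, hO⟩
  · exact hO

theorem verts_subset_growLine (O : List (V × V × E)) (e : E) :
    verts r O ⊆ verts r (N.growLine r O e) := by
  unfold growLine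
  split_ifs <;> simp

theorem ends_mem_growLine {O : List (V × V × E)} {e : E}
    (h : N.src e ∈ verts r O ∨ N.dst e ∈ verts r O) :
    N.src e ∈ verts r (N.growLine r O e) ∧ N.dst e ∈ verts r (N.growLine r O e) := by
  unfold growLine
  split_ifs with h1 h2
  · simp [h1.1]
  · simp [h2.1]
  · tauto

theorem Rooted.foldl_growLine {O : List (V × V × E)} (hO : N.Rooted r O) (L : List E) :
    N.Rooted r (L.foldl (N.growLine r) O) := by
  induction L generalizing O with
  | nil => exact hO
  | cons e L ih => exact ih (hO.growLine e)

theorem verts_subset_foldl_growLine (L : List E) (O : List (V × V × E)) :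
    verts r O ⊆ verts r (L.foldl (N.growLine r) O) := by
  induction L generalizing O with
  | nil => exact List.Subset.refl _
  | cons e L ih => exact List.Subset.trans (verts_subset_growLine O e) (ih _)

theorem ends_mem_foldl_growLine {L : List E} {O : List (V × V × E)} {e : E} (he : e ∈ L)
    (h : N.src e ∈ verts r O ∨ N.dst e ∈ verts r O) :
    N.src e ∈ verts r (L.foldl (N.growLine r) O) ∧
      N.dst e ∈ verts r (L.foldl (N.growLine r) O) := by
  induction L generalizing O with
  | nil => simp at he
  | cons e' L ih =>
    rcases List.mem_cons.1 he with rfl | he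
    · have h1 := ends_mem_growLine h
      exact ⟨verts_subset_foldl_growLine L _ h1.1, verts_subset_foldl_growLine L _ h1.2⟩
    · exact ih he (h.imp (verts_subset_growLine O e' ·) (verts_subset_growLine O e' ·))

/-- Induction along the walk: if the next node is reached after `k` sweeps, the following sweep
meets the joining line and adds its other end. -/
theorem mem_verts_iterate {L : List E} (hL : ∀ e, e ∈ L) {u : V} (p : N.graph.Walk u r) {k : ℕ}
    (hk : p.length ≤ k) : u ∈ verts r ((L.foldl (N.growLine r))^[k] []) := by
  induction p generalizing k with
  | nil =>
    induction k with
    | zero => simp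
    | succ k ih =>
      rw [Function.iterate_succ_apply']
      exact verts_subset_foldl_growLine L _ (ih (Nat.zero_le _))
  | cons h p ih =>
    obtain ⟨k, rfl⟩ : ∃ j, k = j + 1 := ⟨k - 1, by simp at hk; omega⟩
    rw [Function.iterate_succ_apply']
    have h1 := ih (k := k) (by simp at hk; omega)
    obtain ⟨e, he⟩ := h
    rcases Sym2.eq_iff.1 he with ⟨h2, h3⟩ | ⟨h2, h3⟩
    · have := (ends_mem_foldl_growLine (hL e) (Or.inr (h3 ▸ h1))).1
      rwa [h2] at this
    · have := (ends_mem_foldl_growLine (hL e) (Or.inl (h2 ▸ h1))).2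
      rwa [h3] at this

/-- The lines of a tree ordered from the leaves to the root. -/
theorem rooted_iterate [Fintype V] [Fintype E] (hN : N.graph.IsTree) {L : List E}
    (hL : ∀ e, e ∈ L) {k : ℕ} (hk : Fintype.card V ≤ k) :
    N.Rooted r ((L.foldl (N.growLine r))^[k] []) ∧
      (∀ u, u ∈ verts r ((L.foldl (N.growLine r))^[k] [])) ∧
      ∀ e, e ∈ ((L.foldl (N.growLine r))^[k] []).map fun x => x.2.2 := by
  have h1 : ∀ k, N.Rooted r ((L.foldl (N.growLine r))^[k] []) := by
    intro k
    induction k with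
    | zero => trivial
    | succ k ih =>
      rw [Function.iterate_succ_apply']
      exact ih.foldl_growLine L
  have h2 : ∀ u, u ∈ verts r ((L.foldl (N.growLine r))^[k] []) := by
    intro u
    obtain ⟨p, hp⟩ := hN.connected.exists_isPath u r
    exact mem_verts_iterate hL p (hp.length_lt.le.trans hk)
  exact ⟨h1 k, h2, (h1 k).mem_lines hN h2⟩

end FactsNetwork

/-! ### Correctness of the algorithm -/

namespace TreeFlow

open Computability FlowEncoding FactsNetwork

theorem foldr_bit_encodeNat (n : ℕ) : (encodeNat n).foldr Nat.bit 0 = n := by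
  have h : ∀ p : PosNum, (encodePosNum p).foldr Nat.bit 0 = (p : ℕ) := by
    intro p
    induction p with
    | one => rfl
    | bit0 p ih => simp [encodePosNum, ih, Nat.bit_val]; omega
    | bit1 p ih => simp [encodePosNum, ih, Nat.bit_val]; omega
  rw [encodeNat]
  generalize hk : (n : Num) = k
  have h2 : (k : ℕ) = n := by rw [← hk]; simp
  cases k with
  | zero => simpa [encodeNum] using h2
  | pos p => rw [← h2]; exact h p

theorem foldr_parseStep_bits (l : List Bool) (n : ℕ) (cur : List ℕ)
    (x : List ℕ × List (List ℕ) × List (List ℕ) × Bool × Bool) :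
    (l.map Γ'.bit).foldr parseStep (n :: cur, x) = (l.foldr Nat.bit n :: cur, x) := by
  induction l with
  | nil => rfl
  | cons b l ih => rw [List.map_cons, List.foldr_cons, ih]; rfl

theorem foldr_encNat (n : ℕ) (cur : List ℕ)
    (x : List ℕ × List (List ℕ) × List (List ℕ) × Bool × Bool) :
    (encNat n).foldr parseStep (cur, x) = (n :: cur, x) := by
  rw [encNat, List.foldr_append]
  change ((encodeNat n).map Γ'.bit).foldr parseStep (0 :: cur, x) = _
  rw [foldr_parseStep_bits, foldr_bit_encodeNat]

theorem foldr_encRat (q : ℚ≥0) (cur : List ℕ)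
    (x : List ℕ × List (List ℕ) × List (List ℕ) × Bool × Bool) :
    (encRat q).foldr parseStep (cur, x) = (q.num :: q.den :: cur, x) := by
  rw [encRat, List.foldr_append, foldr_encNat, foldr_encNat]

/-- The numbers that describe a line. -/
def lineCode (e : RatLine) : List ℕ :=
  -- The last entry is the `0` with which the parser opened the group.
  [e.src, e.dst, e.susLo.num, e.susLo.den, e.susHi.num, e.susHi.den, e.cap.num, e.cap.den, 0]

/-- The number of a kind of nodes. -/
def kindCode : NodeKind → ℕ
  | .generator => 1
  | .load => 2
  | .plain => 0

theorem foldr_encLines (l : List RatLine) (t : List ℕ) (vs : List (List ℕ)) :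
    (encList encLine l).foldr parseStep (t, [], [], vs, false, false) =
      ([0], t, l.map lineCode, vs, true, false) := by
  induction l with
  | nil => rfl
  | cons e l ih =>
    simp only [encList, encLine, List.foldr_cons, List.foldr_append, ih, foldr_encRat, foldr_encNat]
    rfl

theorem foldr_encNodes (l : List (NodeKind × ℕ)) (t cur : List ℕ) (ls : List (List ℕ)) :
    (encList encNode l).foldr parseStep (cur, t, ls, [], true, false) =
      ([0], t, ls, l.map fun p => [p.2, kindCode p.1], true, true) := by
  induction l with
  | nil => rfl
  | cons p l ih =>
    have h : (encKind p.1).foldr parseStep ([0], t, ls, l.map fun p => [p.2, kindCode p.1],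
        true, true) = ([kindCode p.1], t, ls, l.map fun p => [p.2, kindCode p.1], true, true) := by
      cases p.1 <;> rfl
    simp only [encList, encNode, List.foldr_cons, List.foldr_append, ih, h, foldr_encNat]
    rfl

theorem parse_encInstance (I : FlowInstance) : parse (encInstance I) =
    ([0], [I.threshold.num, I.threshold.den], I.lines.map lineCode,
      I.kinds.zipIdx.map fun p => [p.2, kindCode p.1], true, true) := by
  rw [parse, encInstance, List.foldr_append, List.foldr_append, foldr_encRat, foldr_encLines,
    foldr_encNodes]

/-! ### The numeric lists of the program as images of lists of nodes and lines -/

section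

variable {n : ℕ} {E : Type*}

/-- The numbers that describe an ordered line with a given capacity. -/
def arcCode (c : E → ℕ) (x : Fin n × Fin n × E) : ℕ × ℕ × ℕ :=
  (x.1, x.2.1, c x.2.2)

/-- The program has node `0` as its implicit root. Since `arcCode` forgets only the name of the
line, its tests agree with those of `growLine`. -/
theorem reached_map (c : E → ℕ) {r : Fin n} (hr : (r : ℕ) = 0) (O : List (Fin n × Fin n × E))
    (u : Fin n) : reached (O.map (arcCode c)) u = decide (u ∈ verts r O) := by
  rw [Bool.eq_iff_iff]
  have h : (u : ℕ) = 0 ↔ u = r := by rw [← hr, Fin.ext_iff]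
  simp only [reached, Bool.or_eq_true, beq_iff_eq, List.any_map, List.any_eq_true,
    Function.comp_apply, arcCode, decide_eq_true_eq, verts, List.mem_append, List.mem_map,
    List.mem_singleton, h, Fin.val_inj]
  rw [or_comm]

variable (N : FactsNetwork (Fin n) E) (c : E → ℕ) {r : Fin n}

theorem grow_map (hr : (r : ℕ) = 0) (O : List (Fin n × Fin n × E)) (e : E) :
    grow (O.map (arcCode c)) (arcCode c (N.src e, N.dst e, e)) =
      (N.growLine r O e).map (arcCode c) := by
  have h : ∀ u : Fin n, reached (O.map (arcCode c)) u = decide (u ∈ verts r O) := reached_map c hr O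
  simp only [grow, growLine, arcCode] at h ⊢
  rw [h, h]
  by_cases h1 : N.src e ∈ verts r O <;> by_cases h2 : N.dst e ∈ verts r O <;>
    simp [h1, h2, arcCode]

theorem order_map {ι : Type} (hr : (r : ℕ) = 0) (V : List ι) (L : List E) :
    order V (L.map fun e => arcCode c (N.src e, N.dst e, e)) =
      ((L.foldl (N.growLine r))^[V.length] []).map (arcCode c) := by
  have h : ∀ O, (L.map fun e => arcCode c (N.src e, N.dst e, e)).foldl grow
      (O.map (arcCode c)) = (L.foldl (N.growLine r) O).map (arcCode c) := by
    induction L with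
    | nil => exact fun _ => rfl
    | cons e L ih => exact fun O => by rw [List.map_cons, List.foldl_cons, grow_map N c hr, ih]; rfl
  rw [order, List.foldl_const]
  induction V.length with
  | zero => rfl
  | succ k ih => rw [Function.iterate_succ_apply', Function.iterate_succ_apply', ih, h]

/-- The table of two functions. -/
def table (A B : Fin n → ℕ) : List (ℕ × ℕ × ℕ) :=
  (List.finRange n).map fun u : Fin n => ((u : ℕ), A u, B u)

theorem lookup_table (A B : Fin n → ℕ) (v : Fin n) : lookup (table A B) v = (A v, B v) := by
  have h : ∀ l : List (Fin n), v ∈ l →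
      lookup (l.map fun u : Fin n => ((u : ℕ), A u, B u)) v = (A v, B v) := by
    intro l
    induction l with
    | nil => simp
    | cons a l ih =>
      intro hv
      rw [List.map_cons, lookup_cons]
      by_cases h : a = v
      · simp [h]
      · rw [ih ((List.mem_cons.1 hv).resolve_left (Ne.symm h))]
        rw [beq_eq_false_iff_ne.2 fun h' => h (Fin.ext h'), cond_false]
  exact h _ (List.mem_finRange v)

/-- Contracting in a table changes its two columns precisely as `treeCut` changes its cost
functions. -/
theorem min_lookup_foldl_contract (O : List (Fin n × Fin n × E)) : ∀ A B : Fin n → ℕ,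
    min (lookup ((O.map (arcCode c)).foldl contract (table A B)) r).1
      (lookup ((O.map (arcCode c)).foldl contract (table A B)) r).2 = treeCut r c O A B := by
  induction O with
  | nil => intro A B; simp [lookup_table, treeCut]
  | cons x O ih =>
    intro A B
    rw [treeCut, ← ih, List.map_cons, List.foldl_cons]
    have h : contract (table A B) (arcCode c x) = table
        (fun u => A u + if u = x.2.1 then min (A x.1) (B x.1 + c x.2.2) else 0)
        (fun u => B u + if u = x.2.1 then min (B x.1) (A x.1 + c x.2.2) else 0) := by
      rw [contract]
      simp only [arcCode, lookup_table]
      rw [table, table, List.map_map]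
      refine List.map_congr_left fun u _ => ?_
      by_cases h : u = x.2.1
      · simp [h]
      · simp [h, beq_eq_false_iff_ne.2 fun h' => h (Fin.ext h')]
    rw [h]

theorem cutValue_eq_treeCut [Fintype E] {N : FactsNetwork (Fin n) E} (hr : (r : ℕ) = 0)
    {V Ls : List (List ℕ)} {L : List E} (hV : V.length = n)
    (hL : edges Ls = L.map fun e => arcCode c (N.src e, N.dst e, e))
    {A B : Fin n → ℕ} (hW : initCosts V (L.map c).sum = table A B) :
    cutValue V Ls = treeCut r c ((L.foldl (N.growLine r))^[n] []) A B := by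
  have h : ((edges Ls).map fun e => e.2.2) = L.map c := by
    rw [hL, List.map_map]
    rfl
  rw [← min_lookup_foldl_contract, cutValue, h, hW, hL, order_map N c hr, hV, hr]

end

end TreeFlow

/-! ### Scaling to integral capacities -/

namespace FactsNetwork

open Pointwise

variable {V E : Type*} [Fintype V] [Fintype E]

/-- The network with other capacities. -/
def withCap (N : FactsNetwork V E) (c : E → ℕ) : FactsNetwork V E :=
  { N with cap := fun e => c e, cap_nonneg := fun e => Nat.cast_nonneg (c e) }

/-- Multiplication by `D` maps the flows vanishing on `Z` onto the flows for the new capacities;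
capacity zero is what enforces the vanishing. -/
theorem classicalValues_withCap (N : FactsNetwork V E) {Z : Set E} {D : ℝ} (hD : 0 < D)
    {c : E → ℕ} (hZ : ∀ e ∈ Z, c e = 0) (hc : ∀ e, e ∉ Z → (c e : ℝ) = D * N.cap e) :
    (N.withCap c).classicalValues = D • N.zeroValues Z := by
  classical
  have hk : ∀ (k : ℝ) {f : E → ℝ} {g l : V → ℝ}, N.Kirchhoff f g l →
      N.Kirchhoff (fun e => k * f e) (fun u => k * g u) fun u => k * l u := by
    intro k f g l h a
    have := h a
    rw [← Finset.mul_sum, ← Finset.mul_sum, ← mul_sub, ← mul_sub, this]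
  ext r
  rw [Set.mem_smul_set]
  constructor
  · rintro ⟨f, g, l, h, rfl⟩
    have hD' := inv_nonneg.2 hD.le
    refine ⟨∑ u, D⁻¹ * g u, ⟨fun e => D⁻¹ * f e, fun u => D⁻¹ * g u, fun u => D⁻¹ * l u,
      ⟨fun u => mul_nonneg hD' (h.gen_nonneg u), fun u hu => by rw [h.gen_eq_zero u hu, mul_zero],
      fun u => mul_nonneg hD' (h.load_nonneg u), fun u hu => by rw [h.load_eq_zero u hu, mul_zero],
      hk _ h.kirchhoff, fun e => ?_⟩, fun e he => ?_, rfl⟩, ?_⟩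
    · have h1 : |f e| ≤ c e := h.abs_le_cap e
      rw [abs_mul, abs_of_nonneg hD', inv_mul_le_iff₀ hD]
      by_cases he : e ∈ Z
      · rw [hZ e he] at h1
        exact h1.trans (by simpa using mul_nonneg hD.le (N.cap_nonneg e))
      · rwa [← hc e he]
    · have h1 : |f e| ≤ c e := h.abs_le_cap e
      rw [hZ e he, Nat.cast_zero] at h1
      beta_reduce
      rw [abs_eq_zero.1 (le_antisymm h1 (abs_nonneg _)), mul_zero]
    · rw [smul_eq_mul, ← Finset.mul_sum, mul_inv_cancel_left₀ hD.ne']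
  · rintro ⟨_, ⟨f, g, l, h, h0, rfl⟩, rfl⟩
    refine ⟨fun e => D * f e, fun u => D * g u, fun u => D * l u,
      ⟨fun u => mul_nonneg hD.le (h.gen_nonneg u), fun u hu => by rw [h.gen_eq_zero u hu, mul_zero],
      fun u => mul_nonneg hD.le (h.load_nonneg u),
      fun u hu => by rw [h.load_eq_zero u hu, mul_zero], hk _ h.kirchhoff, fun e => ?_⟩, ?_⟩
    · change |D * f e| ≤ c e
      by_cases he : e ∈ Z
      · simp [h0 e he]
      · rw [hc e he, abs_mul, abs_of_pos hD]
        exact mul_le_mul_of_nonneg_left (h.abs_le_cap e) hD.le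
    · rw [smul_eq_mul, Finset.mul_sum]

/-- The maximum FACTS flow of a tree as a minimum cut. -/
theorem mul_mff_eq_treeCut [DecidableEq V] {N : FactsNetwork V E} (hN : N.graph.IsTree)
    {D : ℝ} (hD : 0 < D) {c : E → ℕ} (hZ : ∀ e, N.susHi e = 0 → c e = 0)
    (hc : ∀ e, N.susHi e ≠ 0 → (c e : ℝ) = D * N.cap e) {L : List E} (hL : ∀ e, e ∈ L)
    {k : ℕ} (hk : Fintype.card V ≤ k) (r : V) {A B : V → ℕ} {M : ℕ} (hM : ∑ e, c e = M)
    (hA : ∀ u, (u ∈ N.loads → A u = M) ∧ (u ∉ N.loads → A u = 0))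
    (hB : ∀ u, (u ∈ N.generators → B u = M) ∧ (u ∉ N.generators → B u = 0)) :
    D * N.mff = (treeCut r c ((L.foldl (N.growLine r))^[k] []) A B : ℕ) := by
  obtain ⟨h1, h2, h3⟩ := rooted_iterate (N := N) (r := r) hN hL hk
  generalize (L.foldl (N.growLine r))^[k] [] = O at *
  have h4 := N.classicalValues_withCap hD (Z := {e | N.susHi e = 0}) hZ hc
  have h5 : (N.withCap c).Rooted r O := by
    -- `Rooted` does not involve capacities, so it carries over line by line.
    clear h2 h3
    induction O with
    | nil => trivial
    | cons x O ih => exact ⟨h1.1, h1.2.1, h1.2.2.1, ih h1.2.2.2⟩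
  rw [mff, N.generationValues_eq hN.isAcyclic, ← smul_eq_mul, ← Real.sSup_smul_of_nonneg hD.le, ← h4]
  have h6 := (N.withCap c).maxFlow_eq_treeCut h5 h2 h3 (M := M)
    (by rw [← hM, Nat.cast_sum]; exact le_rfl)
  rw [treeCut_natCast]
  refine h6.trans ?_
  refine treeCut_congr _ _ h5 (fun u _ => ?_) fun u _ => ?_
  · split_ifs with hu
    · rw [(hA u).1 hu]
    · rw [(hA u).2 hu, Nat.cast_zero]
  · split_ifs with hu
    · rw [(hB u).1 hu]
    · rw [(hB u).2 hu, Nat.cast_zero]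

end FactsNetwork

/-! ### Correctness of the decision procedure -/

namespace TreeFlow

open Computability FlowEncoding FactsNetwork

theorem dens_pos (l : List RatLine) : 0 < dens (l.map lineCode) := by
  induction l with
  | nil => exact Nat.one_pos
  | cons e l ih => exact Nat.mul_pos e.cap.den_pos ih

theorem otherDens_eq_dens {l : List RatLine} {e : RatLine}
    (h : s(e.src, e.dst) ∉ l.map fun e => s(e.src, e.dst)) :
    otherDens (l.map lineCode) (lineCode e) = dens (l.map lineCode) := by
  induction l with
  | nil => rfl
  | cons a l ih =>
    rw [List.map_cons, List.mem_cons, not_or] at h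
    have h1 : (a.src == e.src && a.dst == e.dst) = false := by
      rw [Bool.eq_false_iff]
      intro h2
      simp only [Bool.and_eq_true, beq_iff_eq] at h2
      exact h.1 (by rw [h2.1, h2.2])
    change (bif a.src == e.src && a.dst == e.dst then otherDens (l.map lineCode) (lineCode e) else
      a.cap.den * otherDens (l.map lineCode) (lineCode e)) = a.cap.den * dens (l.map lineCode)
    rw [h1, ih h.2, cond_false]

/-- No two lines have the same ends, so the test on the ends leaves out exactly the factor of `e`.
-/
theorem den_mul_otherDens {l : List RatLine} (hl : (l.map fun e => s(e.src, e.dst)).Nodup)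
    {e : RatLine} (he : e ∈ l) :
    e.cap.den * otherDens (l.map lineCode) (lineCode e) = dens (l.map lineCode) := by
  induction l with
  | nil => simp at he
  | cons a l ih =>
    rw [List.map_cons, List.nodup_cons] at hl
    have h0 : otherDens ((a :: l).map lineCode) (lineCode e) =
      bif a.src == e.src && a.dst == e.dst then otherDens (l.map lineCode) (lineCode e) else
      a.cap.den * otherDens (l.map lineCode) (lineCode e) := rfl
    have h1 : dens ((a :: l).map lineCode) = a.cap.den * dens (l.map lineCode) := rfl
    rw [h0, h1]
    rcases List.mem_cons.1 he with rfl | he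
    · rw [otherDens_eq_dens hl.1]
      simp
    · have h2 : (a.src == e.src && a.dst == e.dst) = false := by
        rw [Bool.eq_false_iff]
        intro h2
        simp only [Bool.and_eq_true, beq_iff_eq] at h2
        exact hl.1 (List.mem_map.2 ⟨e, he, by rw [h2.1, h2.2]⟩)
      rw [h2, ← ih hl.2 he, cond_false, mul_left_comm]

/-- The integral capacity of a line. -/
def intCap (I : FlowInstance) (e : Fin I.lines.length) : ℕ :=
  bif (I.lines.get e).susHi.num == 0 then 0 else
    (I.lines.get e).cap.num * otherDens (I.lines.map lineCode) (lineCode (I.lines.get e))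

theorem map_eq_map_finRange {α β : Type*} (f : α → β) (l : List α) :
    l.map f = (List.finRange l.length).map fun i => f (l.get i) := by
  refine List.ext_getElem (by simp) fun i h1 h2 => ?_
  simp

theorem edges_map_lineCode (I : FlowInstance) : edges (I.lines.map lineCode) =
    (List.finRange I.lines.length).map fun e =>
      arcCode (intCap I) (I.network.src e, I.network.dst e, e) := by
  rw [edges, List.map_map, map_eq_map_finRange]
  rfl

theorem initCosts_zipIdx (I : FlowInstance) (M : ℕ) :
    initCosts (I.kinds.zipIdx.map fun p => [p.2, kindCode p.1]) M =
      table (fun u => bif kindCode (I.kinds.get u) == 2 then M else 0)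
        (fun u => bif kindCode (I.kinds.get u) == 1 then M else 0) := by
  rw [initCosts, table, List.map_map]
  refine List.ext_getElem (by simp) fun i h1 h2 => ?_
  simp

theorem susHi_eq_zero (I : FlowInstance) (e : Fin I.lines.length) :
    I.network.susHi e = 0 ↔ (I.lines.get e).susHi.num = 0 := by
  have h : (I.lines.get e).susHi.num = 0 ↔ (I.lines.get e).susHi = 0 := by
    simp [NNRat.num]
  rw [h]
  exact NNRat.cast_eq_zero

theorem dens_mul_mff (I : FlowInstance) (hI : I.network.graph.IsTree) :
    (dens (I.lines.map lineCode) : ℝ) * I.network.mff =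
      (cutValue (I.kinds.zipIdx.map fun p => [p.2, kindCode p.1]) (I.lines.map lineCode) : ℕ) := by
  -- A tree is nonempty, so node `0` exists and can be the root.
  have := hI.connected.nonempty
  obtain ⟨u⟩ := this
  have hr : ((⟨0, u.pos⟩ : Fin I.kinds.length) : ℕ) = 0 := rfl
  rw [cutValue_eq_treeCut (intCap I) (N := I.network) hr (by simp) (edges_map_lineCode I)
    (initCosts_zipIdx I _)]
  refine mul_mff_eq_treeCut hI (by exact_mod_cast dens_pos I.lines) (fun e he => ?_)
    (fun e he => ?_) List.mem_finRange (by simp) _ (M := ((List.finRange _).map (intCap I)).sum)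
    ?_ (fun u => ?_) (fun u => ?_)
  · rw [susHi_eq_zero] at he
    simp only [intCap, he, beq_self_eq_true, cond_true]
  · rw [Ne, susHi_eq_zero] at he
    have h1 := den_mul_otherDens I.simple (List.get_mem I.lines e)
    rw [intCap, beq_eq_false_iff_ne.2 he, cond_false, ← h1]
    have h2 : I.network.cap e = (I.lines.get e).cap.num / (I.lines.get e).cap.den :=
      NNRat.cast_def _
    have h3 : ((I.lines.get e).cap.den : ℝ) ≠ 0 := Nat.cast_ne_zero.2 (I.lines.get e).cap.den_ne_zero
    rw [h2]
    push_cast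
    field_simp
  · exact (Fin.sum_univ_def _)
  · have h : u ∈ I.network.loads ↔ I.kinds.get u = .load := Iff.rfl
    rw [h]
    cases I.kinds.get u <;> simp [kindCode]
  · have h : u ∈ I.network.generators ↔ I.kinds.get u = .generator := Iff.rfl
    rw [h]
    cases I.kinds.get u <;> simp [kindCode]

theorem decideFlow_encInstance (I : FlowInstance) (hI : I.network.graph.IsTree) :
    decideFlow (encInstance I) = true ↔ (I.threshold : ℝ) ≤ I.network.mff := by
  have h1 := dens_mul_mff I hI
  have h2 : (0 : ℝ) < dens (I.lines.map lineCode) := by exact_mod_cast dens_pos I.lines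
  have h3 : (0 : ℝ) < I.threshold.den := by exact_mod_cast I.threshold.den_pos
  rw [decideFlow, parse_encInstance, decide_eq_true_eq]
  change I.threshold.num * dens (I.lines.map lineCode) ≤ I.threshold.den * cutValue _ _ ↔ _
  rw [← Nat.cast_le (α := ℝ), Nat.cast_mul, Nat.cast_mul, ← h1, NNRat.cast_def, div_le_iff₀ h3,
    mul_comm, mul_left_comm, mul_le_mul_iff_right₀ h2, mul_comm]

end TreeFlow

theorem mainTheorem6 :
    Nonempty (Turing.TM2ComputableInPolyTime
      (fun I : TreeLDCInstance => FlowEncoding.encInstance I.1)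
      Computability.encodeBool msfTreeProblem) ∧
    Nonempty (Turing.TM2ComputableInPolyTime
      (fun I : TreeFactsInstance => FlowEncoding.encInstance I.1)
      Computability.encodeBool mffTreeProblem) ∧
    ∀ (V E : Type*) [Fintype V] [Fintype E] (N : FactsNetwork V E), N.graph.IsAcyclic →
      (∀ (sus f : E → ℝ) (g l : V → ℝ),
        (∀ e, sus e ∈ Set.Icc (N.susLo e) (N.susHi e)) → (∀ e, 0 < sus e) →
        N.IsClassicalFlow f g l → ∃ θ : V → ℝ, N.IsSolution sus θ f g l) ∧
      IsGreatest N.classicalValues N.maxFlow ∧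
      IsGreatest N.generationValues N.mff ∧
      (N.IsLDC → IsGreatest N.switchingValues N.msf) ∧
      ((∀ e, 0 < N.susHi e) → N.mff = N.maxFlow ∧ (N.IsLDC → N.msf = N.maxFlow)) := by
  refine ⟨?_, ?_, fun V E _ _ N hN => N.acyclic_flows hN⟩
  -- One decision procedure serves both problems, because MSF and MFF agree on trees.
  · refine StackProgram.computableInPolyTime_of_polyTime _ _ TreeFlow.poly_decideFlow fun I => ?_
    rw [Bool.eq_iff_iff, TreeFlow.decideFlow_encInstance I.1 I.2.1, msfTreeProblem,
      decide_eq_true_eq, I.1.network.msf_eq_mff I.2.1.isAcyclic]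
  · refine StackProgram.computableInPolyTime_of_polyTime _ _ TreeFlow.poly_decideFlow fun I => ?_
    rw [Bool.eq_iff_iff, TreeFlow.decideFlow_encInstance I.1 I.2, mffTreeProblem,
      decide_eq_true_eq]
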